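/- Equip $\mathbb{RP}^{n-1}$ and $\mathrm{PGL}_n\mathbb R$ with their quotient topologies. A subgeometry $(Y,H)$ of $(\mathbb{RP}^{n-1},\mathrm{PGL}_n\mathbb R)$ consists of a closed subgroup $H\le \mathrm{PGL}_n\mathbb R$ and a nonempty connected open set $Y\subset\mathbb{RP}^{n-1}$ which $H$ preserves and on which $H$ acts transitively. A sequence of closed subgroups $H_m$ converges geometrically to $L$ if every element of $L$ is the limit of a sequence $h_m\in H_m$ and every accumulation point of every sequence $h_m\in H_m$ lies in $L$. A subgeometry $(Z,L)$ is a conjugacy limit of a subgeometry $(Y,H)$ if there are $c_m\in\mathrm{PGL}_n\mathbb R$ such that $c_mHc_m^{-1}$ converges geometrically to $L$ and some $z\in Z$ lies in $c_mY$ for all sufficiently large $m$. The signature of a nondegenerate real quadratic form is $(p,q)$, where $p$ (resp. $q$) is the largest dimension of a subspace on which the form is negative (resp. positive) definite. A partial flag of quadratic forms $(\mathcal F,\boldsymbol\beta)$ on $\mathbb R^n$ consists of subspaces $\mathbb R^n=V_0\supsetneq V_1\supsetneq\dots\supsetneq V_k\supsetneq V_{k+1}=\{0\}$ and a nondegenerate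 quadratic form $\beta_i$, of signature $(p_i,q_i)$, on each quotient $V_i/V_{i+1}$, $0\le i\le k$. Let $\mathrm{P\,Isom}(\mathcal F,\boldsymbol\beta)\le\mathrm{PGL}_n\mathbb R$ be the image of the group of invertible linear maps that preserve every $V_i$ and induce an isometry of every $\beta_i$, and let $\mathsf X(\boldsymbol\beta)=\{[x]\in\mathbb{RP}^{n-1}:\beta_0(x+V_1)<0\}$. Let $\beta$ be a nondegenerate quadratic form on $\mathbb R^n$ of signature $(p,q)$, where $n=p+q$ and $p>0$. Put $\mathsf X(p,q)=\{[x]\in\mathbb{RP}^{n-1}:\beta(x)<0\}$, and let $\mathrm{PO}(p,q)\le\mathrm{PGL}_n\mathbb R$ be the image of the isometry group of $\beta$. **Theorem.** (1) Every conjugacy limit of $(\mathsf X(p,q),\mathrm{PO}(p,q))$ inside $(\mathbb{RP}^{n-1},\mathrm{PGL}_n\mathbb R)$ is equal to $(\mathsf X(\boldsymbol\beta),\mathrm{P\,Isom}(\mathcal F,\boldsymbol\beta))$ for some partial flag of quadratic forms $(\mathcal F,\boldsymbol\beta)$ on $\mathbb R^n$. (2) For every partial flag of quadratic forms $(\mathcal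 F,\boldsymbol\beta)$ on $\mathbb R^n$, the pair $(\mathsf X(\boldsymbol\beta),\mathrm{P\,Isom}(\mathcal F,\boldsymbol\beta))$ is a conjugacy limit of $(\mathsf X(p,q),\mathrm{PO}(p,q))$ if and only if $p_0\neq 0$ and, after exchanging $(p_i,q_i)$ with $(q_i,p_i)$ for the indices $i$ in some (possibly empty) subset of $\{1,\dots,k\}$ (so that $(p_0,q_0)$ is never exchanged), one has $p_0+\dots+p_k=p$ and $q_0+\dots+q_k=q$. -/

import Mathlib

open Filter Topology
open scoped LinearAlgebra.Projectivization MatrixGroups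

/-! ### Projective space and the projective linear group as topological objects

`ℙ ℝ (Fin n → ℝ)` is the projective space of `ℝⁿ` and `PGL(Fin n, ℝ)` is `GL_n(ℝ)` modulo its
center; Mathlib provides the action of the latter on the former. Both carry the quotient topology. -/

noncomputable instance realProjectiveTopology (n : ℕ) : TopologicalSpace (ℙ ℝ (Fin n → ℝ)) :=
  TopologicalSpace.coinduced
    (fun v : {v : Fin n → ℝ // v ≠ 0} => Projectivization.mk ℝ v.1 v.2) inferInstance

noncomputable instance realPGLTopology (n : ℕ) : TopologicalSpace PGL(Fin n, ℝ) :=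
  TopologicalSpace.coinduced
    (fun g : GL (Fin n) ℝ => Matrix.ProjGenLinGroup.mk g) inferInstance

/-! ### Subgeometries and their conjugacy limits -/

section Geometry

variable {G X : Type*} [Group G] [TopologicalSpace G] [TopologicalSpace X] [MulAction G X]

/-- `(Y, H)` is a subgeometry of `(X, G)`: `H` is a closed subgroup of `G` and `Y` is a
(nonempty) connected open subset of `X`, preserved by `H`, on which `H` acts transitively. -/
structure IsSubgeometry (Y : Set X) (H : Subgroup G) : Prop where
  isClosed : IsClosed (H : Set G)
  isOpen : IsOpen Y
  isConnected : IsConnected Y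
  smul_mem : ∀ h ∈ H, ∀ y ∈ Y, h • y ∈ Y
  transitive : ∀ y ∈ Y, ∀ z ∈ Y, ∃ h ∈ H, h • y = z

/-- The sequence of subgroups `H i` converges geometrically to `L`: every element of `L` is the
limit of some sequence `h i ∈ H i`, and every accumulation point of every sequence `h i ∈ H i`
lies in `L`. -/
def ConvergesGeometrically (H : ℕ → Subgroup G) (L : Subgroup G) : Prop :=
  (∀ g ∈ L, ∃ h : ℕ → G, (∀ i, h i ∈ H i) ∧ Tendsto h atTop (𝓝 g)) ∧
  (∀ h : ℕ → G, (∀ i, h i ∈ H i) → ∀ g, MapClusterPt g atTop h → g ∈ L)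

/-- The sequence of subgeometries `(Y i, H i)` converges to `(Z, L)`: the groups converge
geometrically, and some point of `Z` lies in `Y i` for all large `i`. -/
def SubgeometriesConverge (Y : ℕ → Set X) (H : ℕ → Subgroup G) (Z : Set X) (L : Subgroup G) :
    Prop :=
  ConvergesGeometrically H L ∧ ∃ z ∈ Z, ∀ᶠ i in atTop, z ∈ Y i

/-- The subgeometry `(Z, L)` is a conjugacy limit of the subgeometry `(Y, H)`: for some sequence
`c i ∈ G`, the conjugates `(c i Y, c i H (c i)⁻¹)` converge to `(Z, L)`. -/
def IsConjugacyLimit (Y : Set X) (H : Subgroup G) (Z : Set X) (L : Subgroup G) : Prop :=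
  IsSubgeometry Y H ∧ IsSubgeometry Z L ∧
  ∃ c : ℕ → G, SubgeometriesConverge (fun i => (fun y => c i • y) '' Y)
    (fun i => H.map (MulAut.conj (c i)).toMonoidHom) Z L

end Geometry

/-! ### The geometry of a quadratic form -/

section Form

variable {n : ℕ}

/-- `X(β)`, the set of lines on which `β` is negative (independent of the representative since
`β (c • x) = c ^ 2 * β x`). -/
def negativeLines (β : QuadraticForm ℝ (Fin n → ℝ)) : Set (ℙ ℝ (Fin n → ℝ)) :=
  {x | β x.rep < 0}

/-- `Isom(β)`, the linear isometry group of `β`. -/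
def formIsom (β : QuadraticForm ℝ (Fin n → ℝ)) : Subgroup (GL (Fin n) ℝ) where
  carrier := {g | ∀ x : Fin n → ℝ, β (g • x) = β x}
  one_mem' := by intro x; rw [one_smul]
  mul_mem' := by
    intro a b ha hb x
    rw [mul_smul, ha, hb]
  inv_mem' := by
    intro a ha x
    rw [← ha (a⁻¹ • x), smul_inv_smul]

/-- `P Isom(β)`, the image of `Isom(β)` in `PGL_n(ℝ)`. -/
def formPIsom (β : QuadraticForm ℝ (Fin n → ℝ)) : Subgroup PGL(Fin n, ℝ) :=
  (formIsom β).map Matrix.ProjGenLinGroup.mk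

end Form

/-! ### Partial flags of quadratic forms -/

/-- A partial flag `ℝⁿ = V 0 ⊋ V 1 ⊋ ⋯ ⊋ V k ⊋ V (k + 1) = 0` together with a nondegenerate
quadratic form `form i` on each quotient `V i / V (i + 1)`, `0 ≤ i ≤ k`. -/
structure PartialFlagOfForms (n : ℕ) where
  k : ℕ
  V : Fin (k + 2) → Submodule ℝ (Fin n → ℝ)
  V_zero : V 0 = ⊤
  V_last : V (Fin.last (k + 1)) = ⊥
  strictAnti : StrictAnti V
  form : (i : Fin (k + 1)) →
    QuadraticForm ℝ (V i.castSucc ⧸ (V i.succ).submoduleOf (V i.castSucc))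
  nondegenerate : ∀ i, (form i).Nondegenerate

namespace PartialFlagOfForms

variable {n : ℕ} (F : PartialFlagOfForms n)

/-- The value of `form i` on the class of the vector `x ∈ V i`. -/
def value (i : Fin (F.k + 1)) (x : Fin n → ℝ) (hx : x ∈ F.V i.castSucc) : ℝ :=
  F.form i (Submodule.Quotient.mk ⟨x, hx⟩)

/-- The first entry `p_i` of the signature of `form i`: the largest dimension of a subspace on
which the form is negative definite. -/
noncomputable def p (i : Fin (F.k + 1)) : ℕ := sigNeg (F.form i)

/-- The second entry `q_i` of the signature of `form i`: the largest dimension of a subspace on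
which the form is positive definite. -/
noncomputable def q (i : Fin (F.k + 1)) : ℕ := sigPos (F.form i)

theorem mem_V_zero (x : Fin n → ℝ) : x ∈ F.V (0 : Fin (F.k + 1)).castSucc := by
  rw [Fin.castSucc_zero, F.V_zero]
  exact Submodule.mem_top

/-- The domain `X(β)` of all lines on which the first form, on `ℝⁿ / V 1`, is negative. -/
def domain : Set (ℙ ℝ (Fin n → ℝ)) :=
  {x | F.value 0 x.rep (F.mem_V_zero x.rep) < 0}

/-- The group of invertible linear maps that preserve each `V i` (that is, `g (V i) = V i`)
and induce an isometry of each `form i`. -/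
def isom : Subgroup (GL (Fin n) ℝ) where
  carrier := {g | (∀ i (x : Fin n → ℝ), g • x ∈ F.V i ↔ x ∈ F.V i) ∧
    ∀ i (x : Fin n → ℝ) (hx : x ∈ F.V i.castSucc) (hgx : g • x ∈ F.V i.castSucc),
      F.value i (g • x) hgx = F.value i x hx}
  one_mem' := by
    refine ⟨fun i x => by rw [one_smul], fun i x hx hgx => ?_⟩
    congr 1
    exact one_smul _ x
  mul_mem' := by
    rintro a b ⟨ha, ha'⟩ ⟨hb, hb'⟩
    refine ⟨fun i x => by rw [mul_smul, ha, hb], fun i x hx hgx => ?_⟩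
    have h1 : b • x ∈ F.V i.castSucc := (hb _ _).2 hx
    have h2 : a • b • x ∈ F.V i.castSucc := (ha _ _).2 h1
    rw [← hb' i x hx h1, ← ha' i (b • x) h1 h2]
    congr 1
    exact mul_smul a b x
  inv_mem' := by
    rintro a ⟨ha, ha'⟩
    refine ⟨fun i x => by rw [← ha, smul_inv_smul], fun i x hx hgx => ?_⟩
    have h2 : a • a⁻¹ • x ∈ F.V i.castSucc := (ha _ _).2 hgx
    rw [← ha' i (a⁻¹ • x) hgx h2]
    congr 1
    exact smul_inv_smul a x

/-- `P Isom(F, β)`, the image of `isom` in `PGL_n(ℝ)`. -/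
def pIsom : Subgroup PGL(Fin n, ℝ) :=
  F.isom.map Matrix.ProjGenLinGroup.mk

end PartialFlagOfForms

/-!
A conjugate of `PO(p, q)` by `c m` is the projective isometry group of the form
`β m = β ∘ (c m)⁻¹`, so a conjugacy limit describes how a sequence of equivalent forms degenerates.

By the spectral theorem each `β m` is diagonal in an orthonormal basis. Along an ultrafilter these
bases converge, since the orthogonal group is compact, and the absolute values of the eigenvalues
fall into finitely many levels of magnitude, since the ratios of any two of them converge in
`[0, ∞]`. After a rescaling inside each level, `β m` becomes `∑ ± s m (d j) * x j ^ 2` in convergent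
coordinates, where `d j` is the level of the index `j` and `s m i' / s m i → 0` for `i < i'`
(`exists_adapted_coordinates`). The levels define a partial flag, with the form `∑ ± x j ^ 2` on
each successive quotient, to which the limit coordinates are adapted (`IsAdapted`).

The limit of the isometry groups is the isometry group of this partial flag. In adapted coordinates
the latter consists of the block lower triangular matrices whose diagonal blocks are isometries.
If `B` is an isometry of the diagonal form `Q`, then `B⁻¹ = Q⁻¹ * Bᵀ * Q`; comparing entries in the
limit kills the upper blocks and makes the diagonal blocks isometric
(`Matrix.isBlockIsometry_of_tendsto`). Conversely, a block isometry is the product of its diagonal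
part, which is an isometry of every `Q`, and of a unipotent matrix, the Cayley transform of a
strictly lower triangular `X`; adding to `X` the upper part that makes it skew for `Q`, which tends
to zero, gives isometries of `Q` that converge to it (`Matrix.IsBlockIsometry.exists_tendsto`).
The open set of a conjugacy limit is the orbit of a line on which the forms are negative. The first
form of the flag is then nonpositive on this line, and it does not vanish there, because an open
orbit is not contained in the null cone. This gives the first part
(`exists_flag_of_isConjugacyLimit`), and shows that the signatures of this flag add up to `(p, q)`.

A partial flag is determined by its geometry up to the scale of its forms
(`PartialFlagOfForms.exists_mul_of_pIsom_eq`): lifts of reflections of the successive quotients show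
that the subspaces `V i` are the only invariant ones, and that a form invariant under the
reflections of another one is proportional to it. A negative factor exchanges `p i` and `q i`, and
for `i = 0` the factor is positive since the domains agree. So the signature condition is necessary.
It is sufficient because, in adapted coordinates, the forms `∑ ± ε j * (m + 1) ^ (- d j) * x j ^ 2`,
with a minus sign on the levels that are exchanged, degenerate to the partial flag, and they are
equivalent to `β` by Sylvester's law of inertia.
-/

/-! ### The topology of the projective linear group -/

section ProjectiveLinearGroup

variable {n : ℕ} {α : Type*} {f : Filter α}

theorem continuous_projGenLinGroup_mk :
    Continuous (Matrix.ProjGenLinGroup.mk : GL (Fin n) ℝ → PGL(Fin n, ℝ)) :=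
  continuous_coinduced_rng

/-- Convergence in `GL_n(ℝ)` is convergence of the underlying matrices. -/
theorem tendsto_generalLinearGroup {B : α → GL (Fin n) ℝ} {A : GL (Fin n) ℝ}
    (h : Tendsto (fun m => (B m : Matrix (Fin n) (Fin n) ℝ)) f
      (𝓝 (A : Matrix (Fin n) (Fin n) ℝ))) : Tendsto B f (𝓝 A) := by
  have hinv : Tendsto (fun m => ((B m)⁻¹ : GL (Fin n) ℝ).1) f (𝓝 (A⁻¹ : GL (Fin n) ℝ).1) := by
    have hc : ContinuousAt (Ring.inverse : ℝ → ℝ) (A : Matrix (Fin n) (Fin n) ℝ).det := by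
      have : (Ring.inverse : ℝ → ℝ) = fun x => x⁻¹ := by
        ext x; exact Ring.inverse_eq_inv x
      rw [this]
      exact continuousAt_inv₀ (Matrix.GeneralLinearGroup.det A).ne_zero
    have := ((continuousAt_matrix_inv (A : Matrix (Fin n) (Fin n) ℝ) hc).tendsto).comp h
    simpa [Function.comp_def] using this
  rw [Units.isEmbedding_embedProduct.tendsto_nhds_iff]
  refine Tendsto.prodMk_nhds h ?_
  exact (MulOpposite.continuous_op.tendsto _).comp hinv

/-- The products of an entry of `A` and an entry of `A⁻¹` are well defined and continuous on
`PGL_n(ℝ)`. -/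
theorem tendsto_entry_mul_inv_entry {B : α → GL (Fin n) ℝ} {A : GL (Fin n) ℝ}
    (h : Tendsto (fun m => Matrix.ProjGenLinGroup.mk (B m)) f
      (𝓝 (Matrix.ProjGenLinGroup.mk A))) (i j k l : Fin n) :
    Tendsto (fun m => (B m).1 i j * (B m)⁻¹.1 k l) f (𝓝 (A.1 i j * A⁻¹.1 k l)) := by
  let φ : GL (Fin n) ℝ → ℝ := fun B => B.1 i j * B⁻¹.1 k l
  have hφ : Continuous φ := by
    refine Continuous.mul ?_ ?_
    · exact Units.continuous_val.matrix_elem i j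
    · exact (Units.continuous_val.comp continuous_inv).matrix_elem k l
  have hinv : ∀ a b : GL (Fin n) ℝ, Matrix.ProjGenLinGroup.mk a = Matrix.ProjGenLinGroup.mk b →
      φ a = φ b := by
    intro a b hab
    obtain ⟨u, rfl⟩ := Matrix.ProjGenLinGroup.mk_eq_mk_iff.1 hab
    have hu : (u : ℝ) ≠ 0 := u.ne_zero
    -- a scalar factor of the matrix cancels against that of the inverse
    simp only [φ, mul_inv_rev, ← map_inv, Units.val_mul, Matrix.GeneralLinearGroup.coe_scalar,
      Matrix.scalar_apply, Matrix.mul_diagonal, Matrix.diagonal_mul, Units.val_inv_eq_inv_val]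
    field_simp
  let ψ : PGL(Fin n, ℝ) → ℝ := fun x => φ (Function.surjInv Matrix.ProjGenLinGroup.mk_surjective x)
  have hψ : ∀ a, ψ (Matrix.ProjGenLinGroup.mk a) = φ a := fun a =>
    hinv _ _ (Function.surjInv_eq Matrix.ProjGenLinGroup.mk_surjective _)
  have hψc : Continuous ψ := by
    refine continuous_coinduced_dom.2 ?_
    convert hφ using 1
    ext a
    exact hψ a
  have := (hψc.tendsto _).comp h
  simpa [Function.comp_def, hψ, φ] using this

/-- A convergent family in `PGL_n(ℝ)` has a convergent lift to `GL_n(ℝ)`. -/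
theorem exists_tendsto_lift {h : α → PGL(Fin n, ℝ)} {A : GL (Fin n) ℝ}
    (hh : Tendsto h f (𝓝 (Matrix.ProjGenLinGroup.mk A))) :
    ∃ B : α → GL (Fin n) ℝ, (∀ m, Matrix.ProjGenLinGroup.mk (B m) = h m) ∧ Tendsto B f (𝓝 A) := by
  choose C hC using fun m => Matrix.ProjGenLinGroup.mk_surjective (h m)
  obtain rfl | hn := Nat.eq_zero_or_pos n
  · refine ⟨C, hC, ?_⟩
    have : C = fun _ => A := by
      ext m i
      exact i.elim0
    rw [this]
    exact tendsto_const_nhds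
  -- normalize so that a fixed nonzero entry of the inverse stays fixed
  have hne : ∃ k l, A⁻¹.1 k l ≠ 0 := by
    by_contra! hcon
    have h0 : (A⁻¹ : GL (Fin n) ℝ).1 = 0 := by ext k l; exact hcon k l
    have : Nonempty (Fin n) := ⟨⟨0, hn⟩⟩
    exact (A⁻¹ : GL (Fin n) ℝ).ne_zero h0
  obtain ⟨k, l, hkl⟩ := hne
  have hent : ∀ i j, Tendsto (fun m => (C m).1 i j * (C m)⁻¹.1 k l) f
      (𝓝 (A.1 i j * A⁻¹.1 k l)) := fun i j =>
    tendsto_entry_mul_inv_entry (by simpa only [hC] using hh) i j k l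
  have hev : ∀ᶠ m in f, (C m)⁻¹.1 k l ≠ 0 := by
    have hA0 : ∃ i j, A.1 i j ≠ 0 := by
      by_contra! hcon
      have h0 : A.1 = 0 := by ext k l; exact hcon k l
      have : Nonempty (Fin n) := ⟨⟨0, hn⟩⟩
      exact A.ne_zero h0
    obtain ⟨i, j, hij⟩ := hA0
    filter_upwards [(hent i j).eventually_ne (mul_ne_zero hij hkl)] with m hm h0
    exact hm (by rw [h0, mul_zero])
  classical
  let r : α → ℝˣ := fun m =>
    if h0 : (C m)⁻¹.1 k l ≠ 0 then Units.mk0 _ (div_ne_zero h0 hkl) else 1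
  refine ⟨fun m => C m * Matrix.GeneralLinearGroup.scalar (Fin n) (r m), fun m => ?_, ?_⟩
  · rw [map_mul, Matrix.ProjGenLinGroup.mk_scalar, mul_one, hC]
  · refine tendsto_generalLinearGroup ?_
    refine tendsto_pi_nhds.2 fun i => tendsto_pi_nhds.2 fun j => ?_
    have h1 := (hent i j).div_const (A⁻¹.1 k l)
    rw [mul_div_cancel_right₀ _ hkl] at h1
    refine h1.congr' ?_
    filter_upwards [hev] with m hm
    simp only [r, dif_pos hm, Units.val_mul, Matrix.GeneralLinearGroup.coe_scalar,
      Matrix.scalar_apply, Matrix.mul_diagonal, Units.val_mk0]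
    ring

end ProjectiveLinearGroup

/-! ### Limits of isometry groups of diagonal forms -/

section BlockMatrix

open Matrix

variable {ι κ : Type*} [LinearOrder κ] {d : ι → κ}

/-- The block diagonal part of a matrix, for the partition of the index set into the fibres
of `d`. -/
def Matrix.blockPart (d : ι → κ) (A : Matrix ι ι ℝ) : Matrix ι ι ℝ :=
  Matrix.of fun l j => if d l = d j then A l j else 0

theorem Matrix.blockPart_apply (A : Matrix ι ι ℝ) (l j : ι) :
    blockPart d A l j = if d l = d j then A l j else 0 := rfl

theorem Matrix.blockPart_one [DecidableEq ι] : blockPart d (1 : Matrix ι ι ℝ) = 1 := by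
  ext l j
  simp only [blockPart_apply, Matrix.one_apply]
  split_ifs with h1 h2 h2 <;> simp_all

variable [Fintype ι]

/-- Taking block diagonal parts is multiplicative on block lower triangular matrices. -/
theorem Matrix.blockPart_mul {A B : Matrix ι ι ℝ} (hA : ∀ l j, d l < d j → A l j = 0)
    (hB : ∀ l j, d l < d j → B l j = 0) :
    blockPart d (A * B) = blockPart d A * blockPart d B := by
  ext l j
  simp only [blockPart_apply, Matrix.mul_apply]
  split_ifs with h
  · refine Finset.sum_congr rfl fun a _ => ?_
    rcases lt_trichotomy (d l) (d a) with h1 | h1 | h1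
    · simp [hA l a h1]
    · rw [if_pos h1, if_pos (h1.symm.trans h)]
    · rw [hB a j (h ▸ h1)]
      simp
  · refine (Finset.sum_eq_zero fun a _ => ?_).symm
    split_ifs with h1 h2
    · exact absurd (h1.trans h2) h
    all_goals simp

theorem Matrix.mul_blockLower {A B : Matrix ι ι ℝ} (hA : ∀ l j, d l < d j → A l j = 0)
    (hB : ∀ l j, d l < d j → B l j = 0) (l j : ι) (h : d l < d j) : (A * B) l j = 0 := by
  rw [Matrix.mul_apply]
  refine Finset.sum_eq_zero fun a _ => ?_
  rcases lt_or_ge (d l) (d a) with h1 | h1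
  · rw [hA l a h1, zero_mul]
  · rw [hB a j (h1.trans_lt h), mul_zero]

theorem Matrix.mul_strictBlockLower {A B : Matrix ι ι ℝ} (hA : ∀ l j, d l ≤ d j → A l j = 0)
    (hB : ∀ l j, d l < d j → B l j = 0) (l j : ι) (h : d l ≤ d j) : (A * B) l j = 0 := by
  rw [Matrix.mul_apply]
  refine Finset.sum_eq_zero fun a _ => ?_
  rcases le_or_gt (d l) (d a) with h1 | h1
  · rw [hA l a h1, zero_mul]
  · rw [hB a j (h1.trans_le h), mul_zero]

variable [DecidableEq ι]

theorem Matrix.inv_blockLower {A : Matrix ι ι ℝ} (hA : ∀ l j, d l < d j → A l j = 0)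
    (hdet : A.det ≠ 0) (l j : ι) (h : d l < d j) : A⁻¹ l j = 0 := by
  have : Invertible A := Matrix.invertibleOfIsUnitDet A hdet.isUnit
  have hT : A.BlockTriangular (OrderDual.toDual ∘ d) := fun l j h => hA l j h
  exact blockTriangular_inv_of_blockTriangular hT h

/-- A block lower triangular matrix whose diagonal blocks are isometries of the diagonal form
with coefficients `ε`. These are the matrices, in suitable coordinates, of the isometries of a
partial flag of quadratic forms. -/
def Matrix.IsBlockIsometry (d : ι → κ) (ε : ι → ℝ) (A : Matrix ι ι ℝ) : Prop :=
  (∀ l j, d l < d j → A l j = 0) ∧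
    (blockPart d A)ᵀ * diagonal ε * blockPart d A = diagonal ε

/-- The Cayley transform of a skew matrix for the form `Q` is an isometry of `Q`. -/
theorem Matrix.cayley_isometry {Q X : Matrix ι ι ℝ} (hX : Xᵀ * Q = -(Q * X))
    (hdet : (1 - X).det ≠ 0) :
    ((1 + X) * (1 - X)⁻¹)ᵀ * Q * ((1 + X) * (1 - X)⁻¹) = Q := by
  have h1 : (1 + X)ᵀ * Q = Q * (1 - X) := by
    rw [transpose_add, transpose_one, add_mul, one_mul, hX, mul_sub, mul_one, sub_eq_add_neg]
  have h2 : (1 - X)ᵀ * Q = Q * (1 + X) := by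
    rw [transpose_sub, transpose_one, sub_mul, one_mul, hX, mul_add, mul_one, sub_neg_eq_add]
  have h3 : (1 - X) * (1 + X) = (1 + X) * (1 - X) := by noncomm_ring
  have hT : (1 - X)ᵀ.det ≠ 0 := by rwa [det_transpose]
  calc ((1 + X) * (1 - X)⁻¹)ᵀ * Q * ((1 + X) * (1 - X)⁻¹)
      = ((1 - X)ᵀ)⁻¹ * (((1 + X)ᵀ * Q) * (1 + X)) * (1 - X)⁻¹ := by
        rw [transpose_mul, transpose_nonsing_inv]
        simp only [Matrix.mul_assoc]
    _ = ((1 - X)ᵀ)⁻¹ * ((1 - X)ᵀ * Q) * ((1 - X) * (1 - X)⁻¹) := by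
        rw [h1, h2, Matrix.mul_assoc Q, h3]
        simp only [Matrix.mul_assoc]
    _ = Q := by
        rw [mul_nonsing_inv _ hdet.isUnit, Matrix.mul_one, ← Matrix.mul_assoc,
          nonsing_inv_mul _ hT.isUnit, Matrix.one_mul]

/-- A block lower triangular matrix with identity diagonal blocks is a Cayley transform of a
strictly block lower triangular matrix. -/
theorem Matrix.exists_cayley_of_unipotent {U : Matrix ι ι ℝ}
    (hU : ∀ l j, d l < d j → U l j = 0) (hU1 : blockPart d U = 1) :
    ∃ X : Matrix ι ι ℝ, (∀ l j, d l ≤ d j → X l j = 0) ∧ (1 - X).det ≠ 0 ∧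
      (1 + X) * (1 - X)⁻¹ = U := by
  have hsame : ∀ l j, d l = d j → U l j = (1 : Matrix ι ι ℝ) l j := by
    intro l j h
    rw [← hU1, blockPart_apply, if_pos h]
  have hlow : ∀ l j, d l < d j → (1 : Matrix ι ι ℝ) l j = 0 := fun l j h =>
    Matrix.one_apply_ne fun h' => h.ne (congrArg d h')
  have hdet : (U + 1).det ≠ 0 := by
    have hT : (U + 1).BlockTriangular (OrderDual.toDual ∘ d) := fun l j h => by
      rw [Matrix.add_apply, hU l j h, hlow l j h, add_zero]
    rw [hT.det]
    refine Finset.prod_ne_zero_iff.2 fun a _ => ?_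
    have : (U + 1).toSquareBlock (OrderDual.toDual ∘ d) a = (2 : ℝ) • 1 := by
      ext ⟨l, hl⟩ ⟨j, hj⟩
      have hlj : d l = d j := OrderDual.toDual.injective (hl.trans hj.symm)
      simp only [toSquareBlock_def, of_apply, Matrix.add_apply, Matrix.smul_apply, hsame l j hlj,
        Matrix.one_apply, Subtype.mk.injEq, smul_eq_mul]
      ring
    rw [this, det_smul, det_one, mul_one]
    positivity
  have hunit := hdet.isUnit
  refine ⟨(U - 1) * (U + 1)⁻¹, ?_, ?_⟩
  · refine mul_strictBlockLower (fun l j h => ?_) (fun l j h => inv_blockLower ?_ hdet l j h)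
    · rcases h.lt_or_eq with h | h
      · rw [Matrix.sub_apply, hU l j h, hlow l j h, sub_zero]
      · rw [Matrix.sub_apply, hsame l j h, sub_self]
    · intro l j h
      rw [Matrix.add_apply, hU l j h, hlow l j h, add_zero]
  have h1 : 1 - (U - 1) * (U + 1)⁻¹ = (2 : ℝ) • (U + 1)⁻¹ := by
    have h0 : (1 : Matrix ι ι ℝ) = (U + 1) * (U + 1)⁻¹ := (mul_nonsing_inv _ hunit).symm
    calc 1 - (U - 1) * (U + 1)⁻¹ = (U + 1 - (U - 1)) * (U + 1)⁻¹ := by rw [sub_mul _ (U - 1), ← h0]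
      _ = (2 : ℝ) • (U + 1)⁻¹ := by
        rw [show U + 1 - (U - 1) = (2 : ℝ) • (1 : Matrix ι ι ℝ) by rw [two_smul]; abel,
          smul_mul_assoc, one_mul]
  have h2 : 1 + (U - 1) * (U + 1)⁻¹ = (2 : ℝ) • (U * (U + 1)⁻¹) := by
    have h0 : (1 : Matrix ι ι ℝ) = (U + 1) * (U + 1)⁻¹ := (mul_nonsing_inv _ hunit).symm
    calc 1 + (U - 1) * (U + 1)⁻¹ = (U + 1 + (U - 1)) * (U + 1)⁻¹ := by rw [add_mul _ (U - 1), ← h0]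
      _ = (2 : ℝ) • (U * (U + 1)⁻¹) := by
        rw [show U + 1 + (U - 1) = (2 : ℝ) • U by rw [two_smul]; abel, smul_mul_assoc]
  have hd1 : (1 - (U - 1) * (U + 1)⁻¹).det ≠ 0 := by
    rw [h1, det_smul]
    refine mul_ne_zero (by positivity) ?_
    rw [det_nonsing_inv, Ring.inverse_eq_inv]
    exact inv_ne_zero hdet
  refine ⟨hd1, ?_⟩
  have h3 : 1 + (U - 1) * (U + 1)⁻¹ = U * (1 - (U - 1) * (U + 1)⁻¹) := by
    rw [h1, h2, mul_smul_comm]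
  rw [h3, Matrix.mul_assoc, mul_nonsing_inv _ hd1.isUnit, Matrix.mul_one]

variable {α : Type*} {f : Filter α} {ε : ι → ℝ} {s : α → κ → ℝ}

/-- The block diagonal isometries preserve every form obtained by rescaling the blocks. -/
theorem Matrix.blockPart_isometry_smul {A : Matrix ι ι ℝ}
    (hA : (blockPart d A)ᵀ * diagonal ε * blockPart d A = diagonal ε) (t : κ → ℝ) :
    (blockPart d A)ᵀ * diagonal (fun j => ε j * t (d j)) * blockPart d A =
      diagonal fun j => ε j * t (d j) := by
  have h1 : diagonal (fun j => ε j * t (d j)) = diagonal ε * diagonal fun j => t (d j) := by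
    rw [diagonal_mul_diagonal]
  have h2 : (diagonal fun j => t (d j)) * blockPart d A
      = blockPart d A * diagonal fun j => t (d j) := by
    ext l j
    rw [diagonal_mul, mul_diagonal, blockPart_apply]
    split_ifs with h
    · rw [h, mul_comm]
    · simp
  rw [h1, Matrix.mul_assoc, Matrix.mul_assoc, h2, ← Matrix.mul_assoc, ← Matrix.mul_assoc, hA]

/-- Every block isometry is a limit of isometries of the forms `∑ ε j * s m (d j) * x j ^ 2` as
the blocks become incommensurable: the diagonal blocks are isometries of all of these forms, and
the unipotent factor is approximated through its Cayley transform. -/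
theorem Matrix.IsBlockIsometry.exists_tendsto (hε : ∀ j, ε j ≠ 0) (hs : ∀ m i, s m i ≠ 0)
    (hlim : ∀ i i', i < i' → Tendsto (fun m => s m i' / s m i) f (𝓝 0))
    {A : Matrix ι ι ℝ} (hA : IsBlockIsometry d ε A) :
    ∃ B : α → Matrix ι ι ℝ,
      (∀ m, (B m)ᵀ * diagonal (fun j => ε j * s m (d j)) * B m =
        diagonal fun j => ε j * s m (d j)) ∧ Tendsto B f (𝓝 A) := by
  obtain ⟨hlow, horth⟩ := hA
  set D := blockPart d A with hD
  have hDlow : ∀ l j, d l < d j → D l j = 0 := fun l j h => by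
    rw [hD, blockPart_apply, if_neg h.ne]
  have hDD : blockPart d D = D := by
    ext l j
    simp only [hD, blockPart_apply]
    split_ifs <;> rfl
  have hDdet : D.det ≠ 0 := by
    intro h0
    have := congrArg det horth
    rw [det_mul, h0, mul_zero, det_diagonal] at this
    exact Finset.prod_ne_zero_iff.2 (fun j _ => hε j) this.symm
  have hDinvlow := inv_blockLower hDlow hDdet
  -- the unipotent factor of `A`
  obtain ⟨X, hX, hXdet, hXU⟩ := exists_cayley_of_unipotent (d := d) (U := D⁻¹ * A)
    (mul_blockLower hDinvlow hlow) (by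
      rw [blockPart_mul hDinvlow hlow, ← hD]
      nth_rewrite 2 [← hDD]
      rw [← blockPart_mul hDinvlow hDlow, nonsing_inv_mul _ hDdet.isUnit, blockPart_one])
  set q : α → ι → ℝ := fun m j => ε j * s m (d j) with hq
  have hq0 : ∀ m j, q m j ≠ 0 := fun m j => mul_ne_zero (hε j) (hs m _)
  -- the skew matrix with strictly lower part `X`; its upper part tends to zero
  let Y : α → Matrix ι ι ℝ := fun m => of fun j l => X j l - (q m j)⁻¹ * X l j * q m l
  have hY : ∀ m, (Y m)ᵀ * diagonal (q m) = -(diagonal (q m) * Y m) := by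
    intro m
    ext j l
    simp only [Y, mul_diagonal, transpose_apply, of_apply, Matrix.neg_apply, diagonal_mul]
    have := hq0 m j
    have := hq0 m l
    field_simp
    ring
  have hYlim : Tendsto Y f (𝓝 X) := by
    refine tendsto_pi_nhds.2 fun j => tendsto_pi_nhds.2 fun l => ?_
    simp only [Y, of_apply]
    rcases le_or_gt (d l) (d j) with h | h
    · simp only [hX l j h, mul_zero, zero_mul, sub_zero]
      exact tendsto_const_nhds
    · have h1 := ((hlim _ _ h).const_mul ((ε j)⁻¹ * X l j * ε l)).const_sub (X j l)
      rw [mul_zero, sub_zero] at h1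
      refine h1.congr fun m => ?_
      simp only [hq]
      have := hε j
      have := hs m (d j)
      field_simp
  have hone : Tendsto (fun m => 1 - Y m) f (𝓝 (1 - X)) := hYlim.const_sub 1
  have hdetlim : Tendsto (fun m => (1 - Y m).det) f (𝓝 (1 - X).det) :=
    ((continuous_id.matrix_det).tendsto _).comp hone
  have hev : ∀ᶠ m in f, (1 - Y m).det ≠ 0 := hdetlim.eventually_ne hXdet
  classical
  refine ⟨fun m => if (1 - Y m).det ≠ 0 then D * ((1 + Y m) * (1 - Y m)⁻¹) else 1,
    fun m => ?_, ?_⟩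
  · dsimp only
    split_ifs with h
    · have h1 := cayley_isometry (hY m) h
      have h2 := blockPart_isometry_smul (t := s m) horth
      rw [← hD] at h2
      rw [transpose_mul]
      calc _ = ((1 + Y m) * (1 - Y m)⁻¹)ᵀ * (Dᵀ * diagonal (q m) * D)
            * ((1 + Y m) * (1 - Y m)⁻¹) := by simp only [Matrix.mul_assoc]; rfl
        _ = _ := by rw [h2, h1]
    · rw [transpose_one, Matrix.one_mul, Matrix.mul_one]
  · have hinv : Tendsto (fun m => (1 - Y m)⁻¹) f (𝓝 (1 - X)⁻¹) := by
      refine ((continuousAt_matrix_inv (1 - X) ?_).tendsto).comp hone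
      have : (Ring.inverse : ℝ → ℝ) = fun x => x⁻¹ := by
        ext x; exact Ring.inverse_eq_inv x
      rw [this]
      exact continuousAt_inv₀ hXdet
    have hlim' : Tendsto (fun m => D * ((1 + Y m) * (1 - Y m)⁻¹)) f (𝓝 A) := by
      have h1 : D * ((1 + X) * (1 - X)⁻¹) = A := by
        rw [hXU, ← Matrix.mul_assoc, mul_nonsing_inv _ hDdet.isUnit, Matrix.one_mul]
      conv => rhs; rw [← h1]
      exact ((hYlim.const_add 1).mul hinv).const_mul D
    refine hlim'.congr' ?_
    filter_upwards [hev] with m hm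
    rw [if_pos hm]

/-- Limits of similarities of the forms `∑ ε j * s m (d j) * x j ^ 2`, as the blocks become
incommensurable, are block isometries up to scale: an isometry `B` satisfies
`B⁻¹ = Q⁻¹ * Bᵀ * Q`, and in the limit this kills the upper blocks. -/
theorem Matrix.isBlockIsometry_of_tendsto [f.NeBot] [Nonempty ι] (hε : ∀ j, ε j ≠ 0)
    (hs : ∀ m i, s m i ≠ 0)
    (hlim : ∀ i i', i < i' → Tendsto (fun m => s m i' / s m i) f (𝓝 0))
    {B : α → Matrix ι ι ℝ} {r : α → ℝ} (hr : ∀ m, 0 < r m)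
    (hB : ∀ m, (B m)ᵀ * diagonal (fun j => ε j * s m (d j)) * B m =
        r m • diagonal fun j => ε j * s m (d j))
    {A : Matrix ι ι ℝ} (hA : A.det ≠ 0) (hBA : Tendsto B f (𝓝 A)) :
    (∀ l j, d l < d j → A l j = 0) ∧
    ∃ ρ : ℝ, 0 < ρ ∧ (blockPart d A)ᵀ * diagonal ε * blockPart d A = ρ • diagonal ε := by
  set q : α → ι → ℝ := fun m j => ε j * s m (d j) with hq
  have hq0 : ∀ m j, q m j ≠ 0 := fun m j => mul_ne_zero (hε j) (hs m _)
  set N := Fintype.card ι with hN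
  have hN0 : N ≠ 0 := Fintype.card_ne_zero
  have hdet : ∀ m, (B m).det ^ 2 = r m ^ N := by
    intro m
    have h := congrArg det (hB m)
    rw [det_mul, det_mul, det_transpose, det_smul, det_diagonal] at h
    have h0 : ∏ j, q m j ≠ 0 := Finset.prod_ne_zero_iff.2 fun j _ => hq0 m j
    refine mul_right_cancel₀ h0 ?_
    rw [← h]
    ring
  have hdet0 : ∀ m, (B m).det ≠ 0 := fun m h0 => by
    have := hdet m
    rw [h0] at this
    have := pow_pos (hr m) N
    simp_all
  have hdetlim : Tendsto (fun m => (B m).det) f (𝓝 A.det) :=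
    ((continuous_id.matrix_det).tendsto _).comp hBA
  -- the similarity factors converge because their powers are the squares of the determinants
  obtain ⟨ρ, hρ, hrlim⟩ : ∃ ρ : ℝ, 0 < ρ ∧ Tendsto r f (𝓝 ρ) := by
    refine ⟨(A.det ^ 2) ^ ((N : ℝ)⁻¹), by positivity, ?_⟩
    have h1 := (hdetlim.pow 2).rpow_const (p := (N : ℝ)⁻¹) (Or.inl (by positivity))
    refine h1.congr fun m => ?_
    rw [hdet, Real.pow_rpow_inv_natCast (hr m).le hN0]
  have hinv : Tendsto (fun m => (B m)⁻¹) f (𝓝 A⁻¹) := by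
    refine ((continuousAt_matrix_inv A ?_).tendsto).comp hBA
    have : (Ring.inverse : ℝ → ℝ) = fun x => x⁻¹ := by
      ext x; exact Ring.inverse_eq_inv x
    rw [this]
    exact continuousAt_inv₀ hA
  -- the entries of the identity `Bᵀ * Q = r • (Q * B⁻¹)`
  have hent : ∀ m l j, B m l j * q m l = r m * (q m j * (B m)⁻¹ j l) := by
    intro m l j
    have h1 : (B m)ᵀ * diagonal (q m) = r m • (diagonal (q m) * (B m)⁻¹) := by
      rw [← smul_mul_assoc, ← hB m, Matrix.mul_assoc _ (B m), mul_nonsing_inv _ (hdet0 m).isUnit,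
        Matrix.mul_one]
    have h2 := congrFun (congrFun h1 j) l
    rwa [mul_diagonal, Matrix.smul_apply, diagonal_mul, transpose_apply, smul_eq_mul] at h2
  have hBlim : ∀ l j, Tendsto (fun m => B m l j) f (𝓝 (A l j)) := fun l j =>
    (hBA.apply_nhds l).apply_nhds j
  have hIlim : ∀ l j, Tendsto (fun m => (B m)⁻¹ l j) f (𝓝 (A⁻¹ l j)) := fun l j =>
    (hinv.apply_nhds l).apply_nhds j
  have hlow : ∀ l j, d l < d j → A l j = 0 := by
    intro l j h
    refine tendsto_nhds_unique (hBlim l j) ?_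
    have h1 := ((hlim _ _ h).mul (hrlim.mul (hIlim j l))).const_mul (ε j / ε l)
    rw [zero_mul, mul_zero] at h1
    refine h1.congr fun m => ?_
    have h2 := hent m l j
    simp only [hq] at h2
    have := hε l
    have := hs m (d l)
    field_simp
    linear_combination -h2
  refine ⟨hlow, ρ, hρ, ?_⟩
  have hblk : (blockPart d A)ᵀ * diagonal ε = ρ • (diagonal ε * blockPart d A⁻¹) := by
    ext j l
    rw [mul_diagonal, Matrix.smul_apply, diagonal_mul, transpose_apply, smul_eq_mul,
      blockPart_apply, blockPart_apply]
    by_cases h : d l = d j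
    · rw [if_pos h, if_pos h.symm]
      refine tendsto_nhds_unique ((hBlim l j).mul_const _)
        ((hrlim.mul ((hIlim j l).const_mul (ε j))).congr fun m => ?_)
      have h2 := hent m l j
      simp only [hq, h] at h2
      have := hs m (d j)
      refine mul_right_cancel₀ this ?_
      linear_combination -h2
    · rw [if_neg h, if_neg (Ne.symm h)]
      ring
  rw [hblk, smul_mul_assoc, Matrix.mul_assoc, ← blockPart_mul (inv_blockLower hlow hA) hlow,
    nonsing_inv_mul _ hA.isUnit, blockPart_one, Matrix.mul_one]

end BlockMatrix

/-! ### Adapted coordinates of a partial flag of forms -/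

section Adapted

open Matrix

variable {n : ℕ}

theorem generalLinearGroup_smul_eq (g : GL (Fin n) ℝ) (x : Fin n → ℝ) :
    g • x = (g : Matrix (Fin n) (Fin n) ℝ) *ᵥ x := rfl

theorem mk_mem_map_iff {H : Subgroup (GL (Fin n) ℝ)} {g : GL (Fin n) ℝ} :
    Matrix.ProjGenLinGroup.mk g ∈ H.map Matrix.ProjGenLinGroup.mk ↔
      ∃ u : ℝˣ, g * Matrix.GeneralLinearGroup.scalar (Fin n) u ∈ H := by
  constructor
  · rintro ⟨a, ha, hag⟩
    obtain ⟨u, rfl⟩ := Matrix.ProjGenLinGroup.mk_eq_mk_iff.1 hag.symm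
    exact ⟨u, ha⟩
  · rintro ⟨u, hu⟩
    exact ⟨_, hu, Matrix.ProjGenLinGroup.mk_eq_mk_iff.2
      ⟨u⁻¹, by rw [mul_assoc, ← map_mul, mul_inv_cancel, map_one, mul_one]⟩⟩

namespace PartialFlagOfForms

/-- Coordinates `x ↦ P • x` on `ℝⁿ` are adapted to the partial flag of forms `F` if each `V i` is
the coordinate subspace of the indices of level at least `i`, where `d j` is the level of the
index `j`, and the form on `V i / V (i + 1)` is diagonal with coefficients `ε j = ± 1` in the
coordinates of level `i`. -/
structure IsAdapted (F : PartialFlagOfForms n) (P : GL (Fin n) ℝ) (d : Fin n → Fin (F.k + 1))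
    (ε : Fin n → ℝ) : Prop where
  sign : ∀ j, ε j = 1 ∨ ε j = -1
  mem_iff : ∀ i (x : Fin n → ℝ), P • x ∈ F.V i ↔ ∀ j, (d j).castSucc < i → x j = 0
  value_eq : ∀ i (x : Fin n → ℝ) (hx : P • x ∈ F.V i.castSucc),
    F.value i (P • x) hx = ∑ j, if d j = i then ε j * x j ^ 2 else 0

variable {F : PartialFlagOfForms n} {P : GL (Fin n) ℝ} {d : Fin n → Fin (F.k + 1)}
  {ε : Fin n → ℝ}

theorem IsAdapted.ne_zero (h : F.IsAdapted P d ε) (j : Fin n) : ε j ≠ 0 := by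
  rcases h.sign j with h | h <;> rw [h] <;> norm_num

theorem value_congr {i : Fin (F.k + 1)} {x y : Fin n → ℝ} (h : x = y)
    (hx : x ∈ F.V i.castSucc) (hy : y ∈ F.V i.castSucc) : F.value i x hx = F.value i y hy := by
  subst h
  rfl

theorem conj_smul (P A : GL (Fin n) ℝ) (x : Fin n → ℝ) :
    (P * A * P⁻¹) • P • x = P • A • x := by
  rw [mul_smul, mul_smul, inv_smul_smul]

/-- In adapted coordinates, the isometries of a partial flag of forms are the block
isometries. -/
theorem IsAdapted.conj_mem_isom_iff (h : F.IsAdapted P d ε) (A : GL (Fin n) ℝ) :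
    P * A * P⁻¹ ∈ F.isom ↔ IsBlockIsometry d ε (A : Matrix (Fin n) (Fin n) ℝ) := by
  constructor
  · rintro ⟨hV, hval⟩
    have hlow : ∀ l j, d l < d j → A.1 l j = 0 := by
      intro l j hlj
      have h1 : P • (Pi.single j 1 : Fin n → ℝ) ∈ F.V (d j).castSucc := by
        rw [h.mem_iff]
        intro a ha
        refine Pi.single_eq_of_ne ?_ _
        rintro rfl
        exact lt_irrefl _ ha
      rw [← hV, conj_smul, h.mem_iff] at h1
      have := h1 l (Fin.castSucc_lt_castSucc_iff.2 hlj)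
      rwa [generalLinearGroup_smul_eq, mulVec_single_one] at this
    refine ⟨hlow, ?_⟩
    ext j l
    rw [Matrix.mul_apply]
    simp only [mul_diagonal, transpose_apply, diagonal_apply, blockPart_apply]
    by_cases hjl : d j = d l
    swap
    · rw [if_neg (fun h => hjl (congrArg d h))]
      refine Finset.sum_eq_zero fun a _ => ?_
      split_ifs with h1 h2
      · exact absurd (h1.symm.trans h2) hjl
      all_goals simp
    -- polarization: compare the values at `e_j + e_l` and at `e_j - e_l`
    have key : ∀ t : ℝ, ∑ a, (if d a = d j then ε a * (A.1 a j + t * A.1 a l) ^ 2 else 0) =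
        ∑ a, if d a = d j then
          ε a * ((Pi.single j 1 : Fin n → ℝ) a + t * (Pi.single l 1 : Fin n → ℝ) a) ^ 2
          else 0 := by
      intro t
      set x : Fin n → ℝ := Pi.single j 1 + t • Pi.single l 1 with hx
      have hxV : P • x ∈ F.V (d j).castSucc := by
        rw [h.mem_iff]
        intro a ha
        have h1 : a ≠ j := by rintro rfl; exact lt_irrefl _ ha
        have h2 : a ≠ l := by rintro rfl; exact lt_irrefl _ (hjl ▸ ha)
        simp [hx, h1, h2]
      have hgx : (P * A * P⁻¹) • P • x ∈ F.V (d j).castSucc := (hV _ _).2 hxV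
      have h1 := hval _ _ hxV hgx
      rw [value_congr (conj_smul P A x) hgx (conj_smul P A x ▸ hgx), h.value_eq, h.value_eq] at h1
      simpa [hx, generalLinearGroup_smul_eq, mulVec_add, mulVec_smul] using h1
    have h1 := key 1
    have h2 := key (-1)
    have h3 : ∀ u v : Fin n → ℝ,
        (∑ a, if d a = d j then ε a * (u a + 1 * v a) ^ 2 else 0) -
        (∑ a, if d a = d j then ε a * (u a + -1 * v a) ^ 2 else 0) =
        4 * ∑ a, if d a = d j then ε a * u a * v a else 0 := by
      intro u v
      rw [← Finset.sum_sub_distrib, Finset.mul_sum]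
      refine Finset.sum_congr rfl fun a _ => ?_
      split_ifs <;> ring
    have h4 := h3 (fun a => A.1 a j) (fun a => A.1 a l)
    have h5 := h3 (Pi.single j 1) (Pi.single l 1)
    rw [h1, h2, h5] at h4
    have h6 := mul_left_cancel₀ (by norm_num : (4 : ℝ) ≠ 0) h4
    calc _ = ∑ a, if d a = d j then ε a * A.1 a j * A.1 a l else 0 := by
          refine Finset.sum_congr rfl fun a _ => ?_
          rw [hjl]
          split_ifs <;> ring
      _ = _ := by
          rw [← h6, Finset.sum_eq_single j]
          · simp [Pi.single_apply]
          · intro a _ ha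
            simp [Pi.single_apply, ha]
          · simp
  · rintro ⟨hlow, horth⟩
    have hlow' : ∀ l j, d l < d j → A⁻¹.1 l j = 0 := by
      intro l j hlj
      rw [Matrix.coe_units_inv]
      exact inv_blockLower hlow (Matrix.GeneralLinearGroup.det A).ne_zero l j hlj
    have hmem : ∀ B : GL (Fin n) ℝ, (∀ l j, d l < d j → B.1 l j = 0) → ∀ i (x : Fin n → ℝ),
        P • x ∈ F.V i → P • B • x ∈ F.V i := by
      intro B hB i x hx
      rw [h.mem_iff] at hx ⊢
      intro a ha
      rw [generalLinearGroup_smul_eq, mulVec_eq_sum, Finset.sum_apply]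
      refine Finset.sum_eq_zero fun j _ => ?_
      rcases lt_or_ge (d a) (d j) with h1 | h1
      · simp [hB a j h1]
      · simp [hx j ((Fin.castSucc_le_castSucc_iff.2 h1).trans_lt ha)]
    refine ⟨fun i y => ?_, fun i y hy hgy => ?_⟩
    · obtain ⟨x, rfl⟩ : ∃ x, y = P • x := ⟨P⁻¹ • y, by rw [smul_inv_smul]⟩
      rw [conj_smul]
      refine ⟨fun hx => ?_, hmem A hlow i x⟩
      have := hmem A⁻¹ hlow' i _ hx
      rwa [inv_smul_smul] at this
    · obtain ⟨x, rfl⟩ : ∃ x, y = P • x := ⟨P⁻¹ • y, by rw [smul_inv_smul]⟩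
      rw [value_congr (conj_smul P A x) hgy (conj_smul P A x ▸ hgy), h.value_eq, h.value_eq]
      rw [h.mem_iff] at hy
      set x' : Fin n → ℝ := fun j => if d j = i then x j else 0 with hx'
      have hblk : ∀ a, (blockPart d A.1 *ᵥ x') a = if d a = i then (A • x) a else 0 := by
        intro a
        simp only [generalLinearGroup_smul_eq, mulVec, dotProduct, blockPart_apply, hx']
        split_ifs with h1
        · refine Finset.sum_congr rfl fun j _ => ?_
          rcases lt_trichotomy (d j) i with h2 | h2 | h2
          · simp [hy j (Fin.castSucc_lt_castSucc_iff.2 h2)]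
          · simp [h2, h1]
          · simp [h1, h2.ne, h2.ne', hlow a j (h1 ▸ h2)]
        · refine Finset.sum_eq_zero fun j _ => ?_
          split_ifs with h2 h3
          · exact absurd (h2.trans h3) h1
          all_goals simp
      have hdiag : ∀ v : Fin n → ℝ, v ⬝ᵥ (diagonal ε *ᵥ v) = ∑ j, ε j * v j ^ 2 := by
        intro v
        simp only [dotProduct, mulVec_diagonal]
        exact Finset.sum_congr rfl fun j _ => by ring
      have h1 : ∑ j, ε j * (blockPart d A.1 *ᵥ x') j ^ 2 = ∑ j, ε j * x' j ^ 2 := by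
        rw [← hdiag, ← hdiag]
        conv_rhs => rw [← horth, ← mulVec_mulVec, ← mulVec_mulVec, dotProduct_mulVec,
          vecMul_transpose]
      convert h1 using 2 with j _ j _
      · rw [hblk]
        split_ifs <;> simp
      · simp only [hx']
        split_ifs <;> simp

end PartialFlagOfForms

end Adapted

/-! ### Existence of adapted coordinates -/

section AdaptedExistence

open Matrix QuadraticMap

variable {n : ℕ}

theorem eq_zero_of_polar_eq_zero {M : Type*} [AddCommGroup M] [Module ℝ M]
    {Q : QuadraticForm ℝ M} (hQ : Q.Nondegenerate) {x : M}
    (h : ∀ y, polar Q x y = 0) : x = 0 := by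
  have : x ∈ Q.radical := by
    rw [radical_eq_ker_polarBilin, LinearMap.mem_ker]
    ext y
    exact h y
  rwa [hQ.radical_eq_bot, Submodule.mem_bot] at this

theorem nondegenerate_of_polar {M : Type*} [AddCommGroup M] [Module ℝ M]
    {Q : QuadraticForm ℝ M} (h : ∀ x, (∀ y, polar Q x y = 0) → x = 0) : Q.Nondegenerate := by
  rw [nondegenerate_iff_radical_eq_bot, radical_eq_ker_polarBilin, Submodule.eq_bot_iff]
  intro x hx
  exact h x fun y => by
    rw [← polarBilin_apply_apply, LinearMap.mem_ker.1 hx, LinearMap.zero_apply]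

/-- A nondegenerate real quadratic form is a sum of `± 1` squares in suitable coordinates. -/
theorem exists_isometryEquiv_sign {M : Type*} [AddCommGroup M] [Module ℝ M]
    [FiniteDimensional ℝ M] {Q : QuadraticForm ℝ M} (hQ : Q.Nondegenerate) :
    ∃ w : Fin (Module.finrank ℝ M) → ℝ, (∀ i, w i = 1 ∨ w i = -1) ∧
      Q.Equivalent (weightedSumSquares ℝ w) := by
  obtain ⟨w, hw, e⟩ := Q.equivalent_one_neg_one_weighted_sum_squared
    (nondegenerate_associated_iff.2 hQ).1
  exact ⟨w, fun i => (hw i).symm, e⟩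

namespace PartialFlagOfForms

theorem V_le (F : PartialFlagOfForms n) {i j : Fin (F.k + 2)} (h : i ≤ j) : F.V j ≤ F.V i :=
  F.strictAnti.antitone h

/-- The class in `V i / V (i + 1)` of a vector of `V i`. -/
def quot (F : PartialFlagOfForms n) (i : Fin (F.k + 1)) : F.V i.castSucc →ₗ[ℝ]
    (F.V i.castSucc ⧸ (F.V i.succ).submoduleOf (F.V i.castSucc)) :=
  Submodule.mkQ _

theorem quot_eq_zero_iff (F : PartialFlagOfForms n) {i : Fin (F.k + 1)} (x : F.V i.castSucc) :
    F.quot i x = 0 ↔ (x : Fin n → ℝ) ∈ F.V i.succ := by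
  rw [quot, Submodule.mkQ_apply, Submodule.Quotient.mk_eq_zero]
  exact Iff.rfl

theorem value_eq_form_quot (F : PartialFlagOfForms n) {i : Fin (F.k + 1)} (x : Fin n → ℝ)
    (hx : x ∈ F.V i.castSucc) : F.value i x hx = F.form i (F.quot i ⟨x, hx⟩) := rfl

/-- Every partial flag of forms has adapted coordinates: lift orthogonal bases of the successive
quotients. -/
theorem exists_isAdapted (F : PartialFlagOfForms n) :
    ∃ P d ε, F.IsAdapted P d ε := by
  choose w hw e using fun i => exists_isometryEquiv_sign (F.nondegenerate i)
  replace e := fun i => (e i).some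
  set r : Fin (F.k + 1) → ℕ := fun i =>
    Module.finrank ℝ (F.V i.castSucc ⧸ (F.V i.succ).submoduleOf (F.V i.castSucc)) with hr
  have hsurj : ∀ i, Function.Surjective (F.quot i) := fun i => Submodule.mkQ_surjective _
  choose v hv using fun (σ : Σ i, Fin (r i)) => hsurj σ.1 ((e σ.1).symm (Pi.single σ.2 1))
  -- in `V t / V (t + 1)`, a combination of the vectors of level at least `t` has the coordinates
  -- given by its coefficients of level `t`
  have hclass : ∀ (c : (Σ i, Fin (r i)) → ℝ) (t : Fin (F.k + 1)),
      (∀ σ, σ.1 < t → c σ = 0) →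
      ∃ h : ∑ σ, c σ • (v σ : Fin n → ℝ) ∈ F.V t.castSucc,
        F.quot t ⟨_, h⟩ = (e t).symm fun a => c ⟨t, a⟩ := by
    intro c t hc
    have hmem : ∀ σ, c σ • (v σ : Fin n → ℝ) ∈ F.V t.castSucc := by
      intro σ
      rcases lt_or_ge σ.1 t with h | h
      · rw [hc σ h, zero_smul]
        exact zero_mem _
      · exact Submodule.smul_mem _ _
          (F.V_le (Fin.castSucc_le_castSucc_iff.2 h) (v σ).2)
    refine ⟨Submodule.sum_mem _ fun σ _ => hmem σ, ?_⟩
    have h1 : (⟨∑ σ, c σ • (v σ : Fin n → ℝ), Submodule.sum_mem _ fun σ _ => hmem σ⟩ :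
        F.V t.castSucc) = ∑ σ, ⟨c σ • (v σ : Fin n → ℝ), hmem σ⟩ := by
      ext1
      simp
    rw [h1, map_sum, Fintype.sum_sigma, Finset.sum_eq_single t]
    · have h2 : ∀ a, F.quot t ⟨c ⟨t, a⟩ • (v ⟨t, a⟩ : Fin n → ℝ), hmem ⟨t, a⟩⟩ =
          c ⟨t, a⟩ • (e t).symm (Pi.single a 1) := by
        intro a
        rw [← hv ⟨t, a⟩, ← map_smul]
        rfl
      simp only [h2, ← map_smul, ← map_sum]
      congr 1
      ext a
      simp [Pi.single_apply]
    · intro i _ hi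
      refine Finset.sum_eq_zero fun a _ => ?_
      rw [quot_eq_zero_iff]
      rcases lt_or_gt_of_ne hi with h | h
      · simp [hc ⟨i, a⟩ h]
      · exact Submodule.smul_mem _ _ (F.V_le (Fin.succ_le_castSucc_iff.2 h) (v ⟨i, a⟩).2)
    · simp
  -- a combination lies in `V i` if and only if its coefficients of level below `i` vanish: the one
  -- of lowest level would contribute a nonzero class
  have hmem_iff : ∀ (c : (Σ i, Fin (r i)) → ℝ) (i : Fin (F.k + 2)),
      ∑ σ, c σ • (v σ : Fin n → ℝ) ∈ F.V i ↔ ∀ σ, σ.1.castSucc < i → c σ = 0 := by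
    intro c i
    constructor
    · intro hx
      have key : ∀ t : Fin (F.k + 1), t.castSucc < i → ∀ a, c ⟨t, a⟩ = 0 := by
        intro t
        induction t using WellFoundedLT.induction with
        | ind t ih =>
          intro hti a
          obtain ⟨h, hq⟩ := hclass c t fun σ hσ =>
            ih σ.1 hσ ((Fin.castSucc_lt_castSucc_iff.2 hσ).trans hti) σ.2
          have h0 : F.quot t ⟨_, h⟩ = 0 := by
            rw [quot_eq_zero_iff]
            exact F.V_le (Fin.castSucc_lt_iff_succ_le.1 hti) hx
          rw [h0] at hq
          have h2 : (fun a => c ⟨t, a⟩) = 0 := by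
            rw [← (e t).apply_symm_apply (fun a => c ⟨t, a⟩), ← hq, map_zero]
          exact congrFun h2 a
      exact fun σ hσ => key σ.1 hσ σ.2
    · intro hc
      refine Submodule.sum_mem _ fun σ _ => ?_
      rcases lt_or_ge σ.1.castSucc i with h | h
      · rw [hc σ h, zero_smul]
        exact zero_mem _
      · exact Submodule.smul_mem _ _ (F.V_le h (v σ).2)
  have hli : LinearIndependent ℝ fun σ => (v σ : Fin n → ℝ) := by
    rw [Fintype.linearIndependent_iff]
    intro c hc σ
    refine (hmem_iff c (Fin.last _)).1 ?_ σ (Fin.castSucc_lt_last _)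
    rw [hc]
    exact zero_mem _
  have hspan : ∀ i : Fin (F.k + 2),
      F.V i ≤ Submodule.span ℝ (Set.range fun σ => (v σ : Fin n → ℝ)) := by
    intro i
    induction i using Fin.reverseInduction with
    | last => rw [F.V_last]; exact bot_le
    | cast t ih =>
      intro x hx
      set y := e t (F.quot t ⟨x, hx⟩) with hy
      let c : (Σ i, Fin (r i)) → ℝ := fun σ => if h : σ.1 = t then y (h ▸ σ.2) else 0
      obtain ⟨h, hq⟩ := hclass c t fun σ hσ => dif_neg hσ.ne
      have h1 : (fun a => c ⟨t, a⟩) = y := by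
        ext a
        simp [c]
      rw [h1, hy, (e t).symm_apply_apply, ← sub_eq_zero, ← map_sub, quot_eq_zero_iff] at hq
      have h2 := ih hq
      have h3 : ∑ σ, c σ • (v σ : Fin n → ℝ) ∈
          Submodule.span ℝ (Set.range fun σ => (v σ : Fin n → ℝ)) :=
        Submodule.sum_mem _ fun σ _ => Submodule.smul_mem _ _ (Submodule.subset_span ⟨σ, rfl⟩)
      have h4 := Submodule.sub_mem _ h3 h2
      simpa using h4
  have htop : ⊤ ≤ Submodule.span ℝ (Set.range fun σ => (v σ : Fin n → ℝ)) := by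
    rw [← F.V_zero]
    exact hspan 0
  let b := Module.Basis.mk hli htop
  have hcard : Fintype.card (Fin n) = Fintype.card (Σ i, Fin (r i)) := by
    rw [← Module.finrank_eq_card_basis b, Module.finrank_fin_fun, Fintype.card_fin]
  let τ : Fin n ≃ Σ i, Fin (r i) := Fintype.equivOfCardEq hcard
  have hunit : IsUnit (Matrix.of fun a j => (v (τ j) : Fin n → ℝ) a) := by
    rw [← linearIndependent_cols_iff_isUnit]
    exact hli.comp τ τ.injective
  obtain ⟨P, hP⟩ := hunit
  have hPx : ∀ x : Fin n → ℝ, P • x = ∑ σ, x (τ.symm σ) • (v σ : Fin n → ℝ) := by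
    intro x
    rw [generalLinearGroup_smul_eq, hP, ← τ.sum_comp]
    ext a
    simp [mulVec, dotProduct, mul_comm]
  refine ⟨P, fun j => (τ j).1, fun j => w (τ j).1 (τ j).2, fun j => hw _ _, ?_, ?_⟩
  · intro i x
    rw [hPx, hmem_iff]
    constructor
    · intro h j hj
      simpa using h (τ j) hj
    · intro h σ hσ
      exact h (τ.symm σ) (by simpa using hσ)
  · intro i x hx
    have hx' := hx
    rw [hPx, hmem_iff] at hx'
    obtain ⟨h, hq⟩ := hclass (fun σ => x (τ.symm σ)) i fun σ hσ =>
      hx' σ (Fin.castSucc_lt_castSucc_iff.2 hσ)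
    rw [value_congr (hPx x) hx h, value_eq_form_quot, hq, (e i).symm.map_app,
      weightedSumSquares_apply, ← τ.symm.sum_comp, Fintype.sum_sigma, Finset.sum_eq_single i]
    · refine Finset.sum_congr rfl fun a _ => ?_
      have h5 : (fun σ : Σ i, Fin (r i) => w σ.1 σ.2) (τ (τ.symm ⟨i, a⟩)) = w i a := by
        rw [τ.apply_symm_apply]
      dsimp only at h5 ⊢
      rw [h5, if_pos (by rw [τ.apply_symm_apply]), smul_eq_mul, _root_.sq]
    · intro t _ ht
      refine Finset.sum_eq_zero fun a _ => ?_
      simp [ht]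
    · simp

end PartialFlagOfForms

end AdaptedExistence

/-! ### Partial flags with prescribed adapted coordinates -/

section OfCoordinates

open Matrix QuadraticMap

variable {n : ℕ}

/-- The diagonal form with coefficients `w` in the coordinates `x ↦ P • x`. -/
noncomputable def diagonalForm (P : GL (Fin n) ℝ) (w : Fin n → ℝ) :
    QuadraticForm ℝ (Fin n → ℝ) :=
  (weightedSumSquares ℝ w).comp (Matrix.mulVecLin (P⁻¹ : GL (Fin n) ℝ).1)

theorem diagonalForm_apply_smul (P : GL (Fin n) ℝ) (w x : Fin n → ℝ) :
    diagonalForm P w (P • x) = ∑ j, w j * x j ^ 2 := by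
  have h : P⁻¹.1 *ᵥ (P • x) = x := inv_smul_smul P x
  rw [diagonalForm, QuadraticMap.comp_apply, Matrix.mulVecLin_apply, h,
    weightedSumSquares_apply]
  exact Finset.sum_congr rfl fun j _ => by rw [smul_eq_mul, _root_.sq]

theorem polar_diagonalForm (P : GL (Fin n) ℝ) (w x y : Fin n → ℝ) :
    polar (diagonalForm P w) (P • x) (P • y) = ∑ j, 2 * w j * x j * y j := by
  rw [polar, ← smul_add, diagonalForm_apply_smul, diagonalForm_apply_smul,
    diagonalForm_apply_smul, ← Finset.sum_sub_distrib, ← Finset.sum_sub_distrib]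
  exact Finset.sum_congr rfl fun j _ => by rw [Pi.add_apply]; ring

namespace PartialFlagOfForms

section Construction

variable {k : ℕ} (P : GL (Fin n) ℝ) (d : Fin n → Fin (k + 1)) (ε : Fin n → ℝ)

/-- The span of the coordinate vectors of level at least `i`, in the coordinates `x ↦ P • x`. -/
def coordinateSubspace (i : Fin (k + 2)) : Submodule ℝ (Fin n → ℝ) where
  carrier := {x | ∀ j, (d j).castSucc < i → (P⁻¹ • x) j = 0}
  add_mem' {a b} ha hb j hj := by rw [smul_add, Pi.add_apply, ha j hj, hb j hj, add_zero]
  zero_mem' j _ := by rw [smul_zero, Pi.zero_apply]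
  smul_mem' c x hx j hj := by rw [smul_comm, Pi.smul_apply, hx j hj, smul_zero]

theorem smul_mem_coordinateSubspace (i : Fin (k + 2)) (x : Fin n → ℝ) :
    P • x ∈ coordinateSubspace P d i ↔ ∀ j, (d j).castSucc < i → x j = 0 := by
  change (∀ j, (d j).castSucc < i → (P⁻¹ • P • x) j = 0) ↔ _
  rw [inv_smul_smul]

/-- The diagonal form in the coordinates of level `i`. -/
noncomputable def levelForm (i : Fin (k + 1)) : QuadraticForm ℝ (Fin n → ℝ) :=
  diagonalForm P fun j => if d j = i then ε j else 0

theorem levelForm_apply_smul (i : Fin (k + 1)) (x : Fin n → ℝ) :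
    levelForm P d ε i (P • x) = ∑ j, if d j = i then ε j * x j ^ 2 else 0 := by
  rw [levelForm, diagonalForm_apply_smul]
  exact Finset.sum_congr rfl fun j _ => by split_ifs <;> ring

/-- The diagonal form of level `i` descends to the quotient of two consecutive coordinate
subspaces. -/
theorem coordinateSubspace_le_radical (i : Fin (k + 1)) :
    (coordinateSubspace P d i.succ).submoduleOf (coordinateSubspace P d i.castSucc) ≤
      ((levelForm P d ε i).restrict (coordinateSubspace P d i.castSucc)).radical := by
  rintro ⟨x, hx⟩ hx'
  replace hx' : x ∈ coordinateSubspace P d i.succ := hx'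
  rw [radical_eq_ker_polarBilin, LinearMap.mem_ker]
  ext ⟨y, hy⟩
  change polar (levelForm P d ε i) x y = 0
  obtain ⟨x, rfl⟩ : ∃ z, x = P • z := ⟨P⁻¹ • x, by rw [smul_inv_smul]⟩
  obtain ⟨y, rfl⟩ : ∃ z, y = P • z := ⟨P⁻¹ • y, by rw [smul_inv_smul]⟩
  rw [levelForm, polar_diagonalForm]
  rw [smul_mem_coordinateSubspace] at hx'
  refine Finset.sum_eq_zero fun j _ => ?_
  split_ifs with h
  · rw [hx' j (by rw [h]; exact Fin.castSucc_lt_succ), mul_zero, zero_mul]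
  · ring

variable {d ε}

/-- The partial flag of forms for which the coordinates `x ↦ P • x`, with levels `d` and
coefficients `ε`, are adapted. -/
noncomputable def ofCoordinates (hd : Function.Surjective d) (hε : ∀ j, ε j ≠ 0) :
    PartialFlagOfForms n where
  k := k
  V := coordinateSubspace P d
  V_zero := by
    rw [eq_top_iff]
    intro x _ j hj
    exact absurd hj (Fin.not_lt_zero _)
  V_last := by
    rw [eq_bot_iff]
    intro x hx
    have : P⁻¹ • x = 0 := by
      ext j
      exact hx j (Fin.castSucc_lt_last _)
    rw [Submodule.mem_bot, ← smul_inv_smul P x, this, smul_zero]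
  strictAnti := by
    refine Fin.strictAnti_iff_succ_lt.2 fun i => lt_of_le_of_ne ?_ ?_
    · intro x hx j hj
      exact hx j (hj.trans Fin.castSucc_lt_succ)
    · intro h
      obtain ⟨j, rfl⟩ := hd i
      have h1 : P • (Pi.single j 1 : Fin n → ℝ) ∈ coordinateSubspace P d (d j).castSucc := by
        rw [smul_mem_coordinateSubspace]
        intro a ha
        refine Pi.single_eq_of_ne ?_ _
        rintro rfl
        exact lt_irrefl _ ha
      rw [← h, smul_mem_coordinateSubspace] at h1
      simpa using h1 j Fin.castSucc_lt_succ
  form i := ((levelForm P d ε i).restrict (coordinateSubspace P d i.castSucc)).lift _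
    (coordinateSubspace_le_radical P d ε i)
  nondegenerate i := by
    refine nondegenerate_of_polar fun z hz => ?_
    induction z using Submodule.Quotient.induction_on with
    | H x =>
    obtain ⟨x, hx⟩ := x
    obtain ⟨x, rfl⟩ : ∃ z, x = P • z := ⟨P⁻¹ • x, by rw [smul_inv_smul]⟩
    rw [Submodule.Quotient.mk_eq_zero]
    change P • x ∈ coordinateSubspace P d i.succ
    have hx' := hx
    rw [smul_mem_coordinateSubspace] at hx ⊢
    intro j hj
    rcases (Fin.castSucc_lt_succ_iff.1 hj).lt_or_eq with h | h
    · exact hx j (Fin.castSucc_lt_castSucc_iff.2 h)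
    · have hy : P • (Pi.single j 1 : Fin n → ℝ) ∈ coordinateSubspace P d i.castSucc := by
        rw [smul_mem_coordinateSubspace]
        intro a ha
        refine Pi.single_eq_of_ne ?_ _
        rintro rfl
        rw [h] at ha
        exact lt_irrefl _ ha
      have h1 : polar (levelForm P d ε i) (P • x) (P • Pi.single j 1) = 0 :=
        hz (Submodule.Quotient.mk ⟨_, hy⟩)
      rw [levelForm, polar_diagonalForm, Finset.sum_eq_single j] at h1
      · simpa [h, hε j] using h1
      · intro a _ ha
        simp [ha]
      · simp

theorem ofCoordinates_isAdapted (hd : Function.Surjective d) (hε : ∀ j, ε j = 1 ∨ ε j = -1)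
    (hε0 : ∀ j, ε j ≠ 0) : (ofCoordinates P hd hε0).IsAdapted P d ε where
  sign := hε
  mem_iff := smul_mem_coordinateSubspace P d
  value_eq i x _ := levelForm_apply_smul P d ε (k := k) i x

end Construction

/-- The signature of the `i`-th form can be read off adapted coordinates. -/
theorem IsAdapted.form_equivalent {F : PartialFlagOfForms n} {P : GL (Fin n) ℝ}
    {d : Fin n → Fin (F.k + 1)} {ε : Fin n → ℝ} (h : F.IsAdapted P d ε) (i : Fin (F.k + 1)) :
    (F.form i).Equivalent (weightedSumSquares ℝ fun j : {j // d j = i} => ε j) := by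
  let φ : F.V i.castSucc →ₗ[ℝ] ({j // d j = i} → ℝ) :=
    (LinearMap.funLeft ℝ ℝ Subtype.val).comp
      ((Matrix.mulVecLin (P⁻¹ : GL (Fin n) ℝ).1).comp (Submodule.subtype _))
  have hφ : ∀ x (hx : P • x ∈ F.V i.castSucc) j, φ ⟨P • x, hx⟩ j = x j := by
    intro x hx j
    exact congrFun (inv_smul_smul P x) j
  have hker : (F.V i.succ).submoduleOf (F.V i.castSucc) = LinearMap.ker φ := by
    ext ⟨x, hx⟩
    obtain ⟨x, rfl⟩ : ∃ z, x = P • z := ⟨P⁻¹ • x, by rw [smul_inv_smul]⟩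
    change P • x ∈ F.V i.succ ↔ _
    rw [LinearMap.mem_ker, h.mem_iff]
    constructor
    · intro h1
      ext ⟨j, hj⟩
      rw [hφ]
      exact h1 j (hj ▸ Fin.castSucc_lt_succ)
    · intro h1 j hj
      rcases (Fin.castSucc_lt_succ_iff.1 hj).lt_or_eq with h2 | h2
      · exact (h.mem_iff _ _).1 hx j (Fin.castSucc_lt_castSucc_iff.2 h2)
      · have := congrFun h1 ⟨j, h2⟩
        rwa [hφ] at this
  have hsurj : Function.Surjective φ := by
    intro y
    let x : Fin n → ℝ := fun j => if hj : d j = i then y ⟨j, hj⟩ else 0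
    have hx : P • x ∈ F.V i.castSucc := by
      rw [h.mem_iff]
      intro j hj
      exact dif_neg fun h1 => lt_irrefl _ (h1 ▸ hj)
    refine ⟨⟨P • x, hx⟩, ?_⟩
    ext ⟨j, hj⟩
    rw [hφ]
    exact dif_pos hj
  let E := (Submodule.quotEquivOfEq _ _ hker).trans (φ.quotKerEquivOfSurjective hsurj)
  refine ⟨⟨E, fun z => ?_⟩⟩
  induction z using Submodule.Quotient.induction_on with
  | H x =>
  obtain ⟨x, hx⟩ := x
  obtain ⟨x, rfl⟩ : ∃ z, x = P • z := ⟨P⁻¹ • x, by rw [smul_inv_smul]⟩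
  have h1 : E (Submodule.Quotient.mk ⟨P • x, hx⟩) = φ ⟨P • x, hx⟩ := rfl
  change weightedSumSquares ℝ (fun j : {j // d j = i} => ε j)
    (E (Submodule.Quotient.mk ⟨P • x, hx⟩)) = F.value i (P • x) hx
  rw [h1, weightedSumSquares_apply, h.value_eq, ← Finset.sum_filter,
    ← Finset.sum_subtype_eq_sum_filter, Finset.subtype_univ]
  exact Finset.sum_congr rfl fun j _ => by rw [hφ, smul_eq_mul, _root_.sq]

theorem IsAdapted.p_eq {F : PartialFlagOfForms n} {P : GL (Fin n) ℝ}
    {d : Fin n → Fin (F.k + 1)} {ε : Fin n → ℝ} (h : F.IsAdapted P d ε) (i : Fin (F.k + 1)) :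
    F.p i = ∑ j, if d j = i then (if ε j < 0 then 1 else 0) else 0 := by
  rw [p, QuadraticForm.sigNeg_of_equiv_weightedSumSquares (h.form_equivalent i),
    ← Finset.sum_filter, ← Finset.sum_subtype_eq_sum_filter, Finset.subtype_univ,
    ← Finset.card_filter, Set.ncard_eq_toFinset_card']
  congr 1
  ext
  simp

theorem IsAdapted.q_eq {F : PartialFlagOfForms n} {P : GL (Fin n) ℝ}
    {d : Fin n → Fin (F.k + 1)} {ε : Fin n → ℝ} (h : F.IsAdapted P d ε) (i : Fin (F.k + 1)) :
    F.q i = ∑ j, if d j = i then (if 0 < ε j then 1 else 0) else 0 := by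
  rw [q, QuadraticForm.sigPos_of_equiv_weightedSumSquares (h.form_equivalent i),
    ← Finset.sum_filter, ← Finset.sum_subtype_eq_sum_filter, Finset.subtype_univ,
    ← Finset.card_filter, Set.ncard_eq_toFinset_card']
  congr 1
  ext
  simp

end PartialFlagOfForms

theorem sig_of_diagonal {β : QuadraticForm ℝ (Fin n → ℝ)} {P : GL (Fin n) ℝ} {w : Fin n → ℝ}
    (h : ∀ x, β (P • x) = ∑ j, w j * x j ^ 2) :
    sigNeg β = (∑ j, if w j < 0 then 1 else 0) ∧ sigPos β = ∑ j, if 0 < w j then 1 else 0 := by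
  have e : β.Equivalent (weightedSumSquares ℝ w) := by
    refine ⟨⟨(LinearMap.GeneralLinearGroup.generalLinearEquiv ℝ _
      (Matrix.GeneralLinearGroup.toLin P⁻¹)), fun x => ?_⟩⟩
    obtain ⟨x, rfl⟩ : ∃ z, x = P • z := ⟨P⁻¹ • x, by rw [smul_inv_smul]⟩
    have h1 : P⁻¹.1 *ᵥ (P • x) = x := inv_smul_smul P x
    change weightedSumSquares ℝ w (P⁻¹.1 *ᵥ (P • x)) = β (P • x)
    rw [h1, h, weightedSumSquares_apply]
    exact Finset.sum_congr rfl fun j _ => by rw [smul_eq_mul, _root_.sq]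
  rw [QuadraticForm.sigNeg_of_equiv_weightedSumSquares e,
    QuadraticForm.sigPos_of_equiv_weightedSumSquares e, ← Finset.card_filter,
    ← Finset.card_filter, Set.ncard_eq_toFinset_card', Set.ncard_eq_toFinset_card']
  constructor <;> congr 1 <;> ext <;> simp

theorem exists_diagonal_sign {β : QuadraticForm ℝ (Fin n → ℝ)} (hβ : β.Nondegenerate) :
    ∃ (P : GL (Fin n) ℝ) (ε : Fin n → ℝ), (∀ j, ε j = 1 ∨ ε j = -1) ∧
      ∀ x, β (P • x) = ∑ j, ε j * x j ^ 2 := by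
  obtain ⟨w, hw, ⟨e⟩⟩ := exists_isometryEquiv_sign hβ
  let τ : Fin n ≃ Fin (Module.finrank ℝ (Fin n → ℝ)) :=
    finCongr (Module.finrank_fin_fun ℝ).symm
  let E : (Fin n → ℝ) ≃ₗ[ℝ] (Fin n → ℝ) :=
    (LinearEquiv.funCongrLeft ℝ ℝ τ.symm).trans e.toLinearEquiv.symm
  let P : GL (Fin n) ℝ := Matrix.GeneralLinearGroup.toLin.symm
    ((LinearMap.GeneralLinearGroup.generalLinearEquiv ℝ _).symm E)
  have hP : ∀ x, P • x = E x := by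
    intro x
    change (LinearMap.toMatrix' (E : (Fin n → ℝ) →ₗ[ℝ] (Fin n → ℝ))) *ᵥ x = E x
    rw [LinearMap.toMatrix'_mulVec]
    rfl
  refine ⟨P, fun j => w (τ j), fun j => hw _, fun x => ?_⟩
  rw [hP]
  change β (e.symm (x ∘ τ.symm)) = _
  rw [e.symm.map_app, weightedSumSquares_apply, ← τ.sum_comp]
  exact Finset.sum_congr rfl fun j _ => by simp [_root_.sq]

end OfCoordinates

/-! ### Limits of the projective isometry groups -/

section Limits

open Matrix QuadraticMap

variable {n : ℕ}

theorem dotProduct_diagonal_mulVec (w v : Fin n → ℝ) :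
    v ⬝ᵥ (diagonal w *ᵥ v) = ∑ j, w j * v j ^ 2 := by
  simp only [dotProduct, mulVec_diagonal]
  exact Finset.sum_congr rfl fun j _ => by ring

theorem conj_mem_formIsom_iff {β : QuadraticForm ℝ (Fin n → ℝ)} {P : GL (Fin n) ℝ}
    {w : Fin n → ℝ} (h : ∀ x, β (P • x) = ∑ j, w j * x j ^ 2) (A : GL (Fin n) ℝ) :
    P * A * P⁻¹ ∈ formIsom β ↔ (A.1)ᵀ * diagonal w * A.1 = diagonal w := by
  have hval : ∀ x, β ((P * A * P⁻¹) • P • x) = x ⬝ᵥ (((A.1)ᵀ * diagonal w * A.1) *ᵥ x) := by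
    intro x
    rw [PartialFlagOfForms.conj_smul, h, ← dotProduct_diagonal_mulVec, ← mulVec_mulVec,
      ← mulVec_mulVec, dotProduct_mulVec x, vecMul_transpose]
    rfl
  constructor
  · intro hA
    have hsymm : ((A.1)ᵀ * diagonal w * A.1)ᵀ = (A.1)ᵀ * diagonal w * A.1 := by
      rw [transpose_mul, transpose_mul, transpose_transpose, diagonal_transpose, Matrix.mul_assoc]
    set M := (A.1)ᵀ * diagonal w * A.1 - diagonal w with hM
    have hMsymm : Mᵀ = M := by rw [hM, transpose_sub, hsymm, diagonal_transpose]
    have hM0 : ∀ x : Fin n → ℝ, x ⬝ᵥ (M *ᵥ x) = 0 := by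
      intro x
      rw [hM, sub_mulVec, dotProduct_sub, ← hval, hA (P • x), h, dotProduct_diagonal_mulVec,
        sub_self]
    rw [← sub_eq_zero, ← hM]
    ext i j
    -- polarization: evaluate at `e_i + e_j`, `e_i` and `e_j`
    have h1 := hM0 (Pi.single i 1 + Pi.single j 1)
    have h2 := hM0 (Pi.single i 1)
    have h3 := hM0 (Pi.single j 1)
    have h4 : M j i = M i j := congrFun (congrFun hMsymm i) j
    simp only [mulVec_add, add_dotProduct, dotProduct_add, mulVec_single_one,
      single_one_dotProduct, col_apply] at h1 h2 h3
    rw [Matrix.zero_apply]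
    linarith
  · intro hA y
    obtain ⟨x, rfl⟩ : ∃ z, y = P • z := ⟨P⁻¹ • y, by rw [smul_inv_smul]⟩
    rw [hval, hA, h, dotProduct_diagonal_mulVec]

variable {F : PartialFlagOfForms n} {P : GL (Fin n) ℝ} {d : Fin n → Fin (F.k + 1)}
  {ε : Fin n → ℝ}

theorem conj_mul_scalar (P A : GL (Fin n) ℝ) (u : ℝˣ) :
    P * A * P⁻¹ * GeneralLinearGroup.scalar (Fin n) u =
      P * (A * GeneralLinearGroup.scalar (Fin n) u) * P⁻¹ := by
  rw [mul_assoc (P * A), ← GeneralLinearGroup.scalar_commute]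
  group

theorem coe_mul_scalar (A : GL (Fin n) ℝ) (u : ℝˣ) :
    (A * GeneralLinearGroup.scalar (Fin n) u).1 = (u : ℝ) • A.1 := by
  ext i j
  simp [mul_comm]

/-- In adapted coordinates, membership in `P Isom` is being a block similarity. -/
theorem PartialFlagOfForms.IsAdapted.mk_conj_mem_pIsom_iff (h : F.IsAdapted P d ε)
    (A : GL (Fin n) ℝ) :
    Matrix.ProjGenLinGroup.mk (P * A * P⁻¹) ∈ F.pIsom ↔
      (∀ l j, d l < d j → A.1 l j = 0) ∧
      ∃ ρ : ℝ, 0 < ρ ∧ (blockPart d A.1)ᵀ * diagonal ε * blockPart d A.1 = ρ • diagonal ε := by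
  have hsmul : ∀ c : ℝ, blockPart d (c • A.1) = c • blockPart d A.1 := by
    intro c
    ext l j
    simp only [blockPart_apply, Matrix.smul_apply, smul_eq_mul, mul_ite, mul_zero]
  rw [PartialFlagOfForms.pIsom, mk_mem_map_iff]
  simp only [conj_mul_scalar, h.conj_mem_isom_iff, coe_mul_scalar, IsBlockIsometry, hsmul,
    transpose_smul, smul_mul_assoc, mul_smul_comm, smul_smul, Matrix.smul_apply, smul_eq_mul,
    mul_eq_zero]
  constructor
  · rintro ⟨u, h1, h2⟩
    have hu : (u : ℝ) ≠ 0 := u.ne_zero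
    refine ⟨fun l j hlj => (h1 l j hlj).resolve_left hu, ((u : ℝ) * u)⁻¹,
      inv_pos.2 (mul_self_pos.2 hu), ?_⟩
    conv_rhs => rw [← h2]
    rw [smul_smul, inv_mul_cancel₀ (mul_ne_zero hu hu), one_smul]
  · rintro ⟨h1, ρ, hρ, h2⟩
    refine ⟨Units.mk0 (Real.sqrt ρ)⁻¹ (by positivity), fun l j hlj => Or.inr (h1 l j hlj), ?_⟩
    rw [h2, smul_smul, Units.val_mk0, ← mul_inv, Real.mul_self_sqrt hρ.le,
      inv_mul_cancel₀ hρ.ne', one_smul]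

theorem exists_conj_eq (P G : GL (Fin n) ℝ) : ∃ A, G = P * A * P⁻¹ :=
  ⟨P⁻¹ * G * P, by group⟩

variable {α : Type*} {f : Filter α} {s : α → Fin (F.k + 1) → ℝ} {Pm : α → GL (Fin n) ℝ}
  {βm : α → QuadraticForm ℝ (Fin n → ℝ)}

/-- If the forms `βm m` are `∑ ε j * s m (d j) * x j ^ 2` in coordinates converging to coordinates
adapted to `F`, and the scales `s m i` of different levels become incommensurable, then every
element of `P Isom(F)` is a limit of elements of the groups `P Isom(βm m)`. -/
theorem PartialFlagOfForms.IsAdapted.exists_tendsto_of_mem_pIsom (h : F.IsAdapted P d ε)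
    (hs : ∀ m i, s m i ≠ 0)
    (hlim : ∀ i i', i < i' → Tendsto (fun m => s m i' / s m i) f (𝓝 0))
    (hP : Tendsto Pm f (𝓝 P))
    (hβ : ∀ m x, βm m (Pm m • x) = ∑ j, ε j * s m (d j) * x j ^ 2)
    {g : PGL(Fin n, ℝ)} (hg : g ∈ F.pIsom) :
    ∃ h : α → PGL(Fin n, ℝ), (∀ m, h m ∈ formPIsom (βm m)) ∧ Tendsto h f (𝓝 g) := by
  obtain ⟨G, hG, rfl⟩ := hg
  obtain ⟨A, rfl⟩ := exists_conj_eq P G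
  obtain ⟨B, hB, hBA⟩ := ((h.conj_mem_isom_iff A).1 hG).exists_tendsto h.ne_zero hs hlim
  have hdet : ∀ m, (B m).det ≠ 0 := by
    intro m h0
    have := congrArg det (hB m)
    rw [det_mul, h0, mul_zero, det_diagonal] at this
    exact Finset.prod_ne_zero_iff.2 (fun j _ => mul_ne_zero (h.ne_zero j) (hs m _)) this.symm
  let C : α → GL (Fin n) ℝ := fun m => GeneralLinearGroup.mkOfDetNeZero (B m) (hdet m)
  have hC : Tendsto C f (𝓝 A) := tendsto_generalLinearGroup hBA
  refine ⟨fun m => Matrix.ProjGenLinGroup.mk (Pm m * C m * (Pm m)⁻¹), fun m => ?_, ?_⟩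
  · exact ⟨_, (conj_mem_formIsom_iff (hβ m) (C m)).2 (hB m), rfl⟩
  · exact (continuous_projGenLinGroup_mk.tendsto _).comp ((hP.mul hC).mul hP.inv)

/-- In the situation of `exists_tendsto_of_mem_pIsom`, limits of elements of the groups
`P Isom(βm m)` belong to `P Isom(F)`. -/
theorem PartialFlagOfForms.IsAdapted.mem_pIsom_of_tendsto [f.NeBot] (hn : 0 < n)
    (h : F.IsAdapted P d ε) (hs : ∀ m i, s m i ≠ 0)
    (hlim : ∀ i i', i < i' → Tendsto (fun m => s m i' / s m i) f (𝓝 0))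
    (hP : Tendsto Pm f (𝓝 P))
    (hβ : ∀ m x, βm m (Pm m • x) = ∑ j, ε j * s m (d j) * x j ^ 2)
    {hm : α → PGL(Fin n, ℝ)} (hhm : ∀ m, hm m ∈ formPIsom (βm m)) {g : PGL(Fin n, ℝ)}
    (hg : Tendsto hm f (𝓝 g)) : g ∈ F.pIsom := by
  obtain ⟨G, rfl⟩ := Matrix.ProjGenLinGroup.mk_surjective g
  obtain ⟨C, hC, hCG⟩ := exists_tendsto_lift hg
  have hu : ∀ m, ∃ u : ℝˣ, C m * GeneralLinearGroup.scalar (Fin n) u ∈ formIsom (βm m) := by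
    intro m
    rw [← mk_mem_map_iff, hC]
    exact hhm m
  choose u hu using hu
  obtain ⟨A, rfl⟩ := exists_conj_eq P G
  rw [h.mk_conj_mem_pIsom_iff]
  have : Nonempty (Fin n) := ⟨⟨0, hn⟩⟩
  let B : α → GL (Fin n) ℝ := fun m => (Pm m)⁻¹ * C m * Pm m
  have hBlim : Tendsto B f (𝓝 A) := by
    have := (hP.inv.mul hCG).mul hP
    simpa only [show P⁻¹ * (P * A * P⁻¹) * P = A by group] using this
  have hBC : ∀ m, C m = Pm m * B m * (Pm m)⁻¹ := fun m => by
    simp only [B]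
    group
  refine isBlockIsometry_of_tendsto (B := fun m => (B m).1) (r := fun m => ((u m : ℝ) * u m)⁻¹)
    h.ne_zero hs hlim (fun m => ?_) (fun m => ?_) (GeneralLinearGroup.det A).ne_zero
    ((Units.continuous_val.tendsto A).comp hBlim)
  · exact inv_pos.2 (mul_self_pos.2 (u m).ne_zero)
  · have h1 := hu m
    rw [hBC, conj_mul_scalar, conj_mem_formIsom_iff (hβ m), coe_mul_scalar, transpose_smul,
      smul_mul_assoc, smul_mul_assoc, mul_smul_comm, smul_smul] at h1
    have : (u m : ℝ) * u m ≠ 0 := mul_ne_zero (u m).ne_zero (u m).ne_zero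
    conv_rhs => rw [← h1]
    rw [smul_smul, inv_mul_cancel₀ this, one_smul]

theorem PartialFlagOfForms.isClosed_pIsom (hn : 0 < n) (F : PartialFlagOfForms n) :
    IsClosed (F.pIsom : Set PGL(Fin n, ℝ)) := by
  obtain ⟨P, d, ε, h⟩ := F.exists_isAdapted
  have : Nonempty (Fin n) := ⟨⟨0, hn⟩⟩
  let j₀ : Fin n := Classical.arbitrary _
  refine isClosed_coinduced.2 ?_
  let b : GL (Fin n) ℝ → Matrix (Fin n) (Fin n) ℝ := fun G =>
    (blockPart d (P⁻¹ * G * P).1)ᵀ * diagonal ε * blockPart d (P⁻¹ * G * P).1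
  have hconj : Continuous fun G : GL (Fin n) ℝ => (P⁻¹ * G * P).1 :=
    Units.continuous_val.comp ((continuous_const.mul continuous_id).mul continuous_const)
  have hblk : Continuous fun G : GL (Fin n) ℝ => blockPart d (P⁻¹ * G * P).1 := by
    refine continuous_matrix fun l j => ?_
    simp only [blockPart_apply]
    split_ifs
    · exact hconj.matrix_elem l j
    · exact continuous_const
  have hb : Continuous b := (hblk.matrix_transpose.mul continuous_const).mul hblk
  -- the similarity factor is read off a diagonal entry; it is a nonnegative number, and it does
  -- not vanish since the diagonal blocks are invertible
  have heq : (Matrix.ProjGenLinGroup.mk ⁻¹' (F.pIsom : Set PGL(Fin n, ℝ)) : Set (GL (Fin n) ℝ)) =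
      (⋂ (l) (j) (_ : d l < d j), {G | (P⁻¹ * G * P).1 l j = 0}) ∩
      ({G | 0 ≤ ε j₀ * b G j₀ j₀} ∩ {G | b G = (ε j₀ * b G j₀ j₀) • diagonal ε}) := by
    ext G
    obtain ⟨A, rfl⟩ := exists_conj_eq P G
    have hA : P⁻¹ * (P * A * P⁻¹) * P = A := by group
    have hε2 : ε j₀ * ε j₀ = 1 := by rcases h.sign j₀ with h | h <;> rw [h] <;> norm_num
    simp only [Set.mem_preimage, SetLike.mem_coe, h.mk_conj_mem_pIsom_iff, Set.mem_inter_iff,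
      Set.mem_iInter, Set.mem_ofPred_eq, b, hA]
    refine and_congr_right fun hlow => ⟨?_, ?_⟩
    · rintro ⟨ρ, hρ, h1⟩
      have h2 : ε j₀ * (ρ • diagonal ε : Matrix (Fin n) (Fin n) ℝ) j₀ j₀ = ρ := by
        rw [Matrix.smul_apply, diagonal_apply_eq, smul_eq_mul]
        linear_combination ρ * hε2
      rw [h1, h2]
      exact ⟨hρ.le, rfl⟩
    · rintro ⟨h1, h2⟩
      refine ⟨_, lt_of_le_of_ne h1 fun h0 => ?_, h2⟩
      rw [← h0, zero_smul] at h2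
      have hAi : blockPart d A⁻¹.1 * blockPart d A.1 = 1 := by
        rw [← blockPart_mul (fun l j hlj => ?_) hlow, ← Units.val_mul, inv_mul_cancel,
          Units.val_one, blockPart_one]
        rw [Matrix.coe_units_inv]
        exact inv_blockLower hlow (GeneralLinearGroup.det A).ne_zero l j hlj
      have h3 := congrArg det h2
      have h4 := congrArg det hAi
      rw [det_mul, det_mul, det_transpose, det_diagonal, det_zero] at h3
      rw [det_mul, det_one] at h4
      have h5 : (blockPart d A.1).det ≠ 0 := fun h6 => by
        rw [h6, mul_zero] at h4
        exact zero_ne_one h4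
      have h6 : ∏ j, ε j ≠ 0 := Finset.prod_ne_zero_iff.2 fun j _ => h.ne_zero j
      exact mul_ne_zero (mul_ne_zero h5 h6) h5 h3
  change IsClosed (Matrix.ProjGenLinGroup.mk ⁻¹' (F.pIsom : Set PGL(Fin n, ℝ)) :
    Set (GL (Fin n) ℝ))
  rw [heq]
  have hφ : Continuous fun G => ε j₀ * b G j₀ j₀ := continuous_const.mul (hb.matrix_elem j₀ j₀)
  refine IsClosed.inter ?_ (IsClosed.inter (isClosed_le continuous_const hφ)
    (isClosed_eq hb (hφ.smul continuous_const)))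
  exact isClosed_iInter fun l => isClosed_iInter fun j => isClosed_iInter fun _ =>
    isClosed_eq (hconj.matrix_elem l j) continuous_const

end Limits

/-! ### The lines on which a quadratic form is negative -/

section NegativeLines

open QuadraticMap

variable {n : ℕ}

theorem mk_mem_negativeLines_iff {Q : QuadraticForm ℝ (Fin n → ℝ)} {v : Fin n → ℝ} (hv : v ≠ 0) :
    Projectivization.mk ℝ v hv ∈ negativeLines Q ↔ Q v < 0 := by
  obtain ⟨a, ha⟩ := Projectivization.exists_smul_eq_mk_rep ℝ v hv
  have ha0 : (a : ℝ) * a > 0 := mul_self_pos.2 a.ne_zero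
  change Q (Projectivization.mk ℝ v hv).rep < 0 ↔ _
  rw [← ha, Units.smul_def, QuadraticMap.map_smul, smul_eq_mul]
  exact ⟨fun h => (pos_iff_neg_of_mul_neg h).1 ha0, fun h => mul_neg_of_pos_of_neg ha0 h⟩

theorem quadraticForm_eq_dotProduct (Q : QuadraticForm ℝ (Fin n → ℝ)) (x : Fin n → ℝ) :
    Q x = x ⬝ᵥ (QuadraticForm.toMatrix' Q).mulVec x := by
  rw [QuadraticForm.toMatrix', ← Matrix.toLinearMap₂'_apply', Matrix.toLinearMap₂'_toMatrix',
    associated_eq_self_apply]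

theorem continuous_quadraticForm (Q : QuadraticForm ℝ (Fin n → ℝ)) : Continuous Q := by
  simp_rw [funext (quadraticForm_eq_dotProduct Q)]
  fun_prop

theorem isOpen_negativeLines (Q : QuadraticForm ℝ (Fin n → ℝ)) : IsOpen (negativeLines Q) := by
  refine isOpen_coinduced.2 ?_
  have : (fun v : {v : Fin n → ℝ // v ≠ 0} => Projectivization.mk ℝ v.1 v.2) ⁻¹' negativeLines Q =
      {v | Q v.1 < 0} := by
    ext v
    exact mk_mem_negativeLines_iff v.2
  rw [this]
  exact isOpen_lt ((continuous_quadraticForm Q).comp continuous_subtype_val) continuous_const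

theorem map_add_polar (Q : QuadraticForm ℝ (Fin n → ℝ)) (x y : Fin n → ℝ) (a b : ℝ) :
    Q (a • x + b • y) = a * a * Q x + a * b * polar Q x y + b * b * Q y := by
  rw [QuadraticMap.map_add Q, QuadraticMap.map_smul, QuadraticMap.map_smul, polar_smul_left,
    polar_smul_right]
  simp only [smul_eq_mul]
  ring

/-- The set of lines on which `Q` is negative is connected: every such line has a representative
`v` with `B(v, e) ≤ 0`, for a fixed vector `e` with `Q e < 0`, and the set of all these
representatives is star-shaped about `e`. -/
theorem isConnected_negativeLines {Q : QuadraticForm ℝ (Fin n → ℝ)} {e : Fin n → ℝ}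
    (he : Q e < 0) : IsConnected (negativeLines Q) := by
  set S : Set (Fin n → ℝ) := {v | Q v < 0 ∧ polar Q v e ≤ 0} with hS
  have hne : ∀ v, Q v < 0 → v ≠ 0 := by
    rintro v hv rfl
    rw [QuadraticMap.map_zero] at hv
    exact lt_irrefl _ hv
  have heS : e ∈ S := by
    refine ⟨he, ?_⟩
    rw [polar_self, two_nsmul]
    linarith
  have hstar : StarConvex ℝ e S := by
    rw [starConvex_iff_forall_pos heS]
    rintro v ⟨hv1, hv2⟩ a b ha hb -
    refine ⟨?_, ?_⟩
    · rw [map_add_polar, polar_comm]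
      nlinarith [mul_pos ha hb, mul_pos ha ha, mul_pos hb hb,
        mul_pos (mul_pos ha ha) (neg_pos.2 he), mul_pos (mul_pos hb hb) (neg_pos.2 hv1), mul_nonneg (mul_pos ha hb).le (neg_nonneg.2 hv2)]
    · rw [polar_add_left, polar_smul_left, polar_smul_left, polar_self, two_nsmul]
      simp only [smul_eq_mul]
      nlinarith [mul_pos ha (neg_pos.2 he), mul_nonneg hb.le (neg_nonneg.2 hv2)]
  have hconn : IsConnected S := (hstar.isPathConnected heS).isConnected
  let T : Set {v : Fin n → ℝ // v ≠ 0} := Subtype.val ⁻¹' S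
  have hT : IsConnected T := by
    refine ⟨⟨⟨e, hne e he⟩, heS⟩, ?_⟩
    have hind := (Topology.IsEmbedding.subtypeVal (p := fun v : Fin n → ℝ => v ≠ 0)).isInducing
    rw [← hind.isPreconnected_image,
      Set.image_preimage_eq_of_subset fun v hv => ⟨⟨v, hne v hv.1⟩, rfl⟩]
    exact hconn.isPreconnected
  have himage : (fun v : {v : Fin n → ℝ // v ≠ 0} => Projectivization.mk ℝ v.1 v.2) '' T =
      negativeLines Q := by
    ext x
    constructor
    · rintro ⟨v, hv, rfl⟩
      exact (mk_mem_negativeLines_iff v.2).2 hv.1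
    · induction x using Projectivization.ind with
      | h v hv =>
      intro hx
      rw [mk_mem_negativeLines_iff] at hx
      rcases le_total (polar Q v e) 0 with h | h
      · exact ⟨⟨v, hv⟩, ⟨hx, h⟩, rfl⟩
      · refine ⟨⟨-v, neg_ne_zero.2 hv⟩, ⟨?_, ?_⟩, ?_⟩
        · rwa [QuadraticMap.map_neg]
        · rw [polar_neg_left]
          linarith
        · exact (Projectivization.mk_eq_mk_iff' ℝ _ _ _ _).2 ⟨-1, by simp⟩
  rw [← himage]
  exact hT.image _ continuous_coinduced_rng.continuousOn

end NegativeLines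

/-! ### Reflections of a partial flag of forms -/

section Reflections

open QuadraticMap

variable {n : ℕ}

/-- The matrix of an automorphism of `ℝⁿ`. -/
noncomputable def matrixOfEquiv (E : (Fin n → ℝ) ≃ₗ[ℝ] (Fin n → ℝ)) : GL (Fin n) ℝ :=
  Matrix.GeneralLinearGroup.toLin.symm
    ((LinearMap.GeneralLinearGroup.generalLinearEquiv ℝ _).symm E)

theorem matrixOfEquiv_smul (E : (Fin n → ℝ) ≃ₗ[ℝ] (Fin n → ℝ)) (x : Fin n → ℝ) :
    matrixOfEquiv E • x = E x := by
  change (LinearMap.toMatrix' (E : (Fin n → ℝ) →ₗ[ℝ] (Fin n → ℝ))).mulVec x = E x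
  rw [LinearMap.toMatrix'_mulVec]
  rfl

namespace PartialFlagOfForms

variable (F : PartialFlagOfForms n)

theorem value_eq_of_sub_mem {i : Fin (F.k + 1)} {x y : Fin n → ℝ} (hx : x ∈ F.V i.castSucc)
    (hy : y ∈ F.V i.castSucc) (h : x - y ∈ F.V i.succ) : F.value i x hx = F.value i y hy := by
  have : F.quot i ⟨x, hx⟩ = F.quot i ⟨y, hy⟩ := by
    rw [← sub_eq_zero, ← map_sub, quot_eq_zero_iff]
    exact h
  rw [value_eq_form_quot, value_eq_form_quot, this]

theorem matrixOfEquiv_mem_isom {E : (Fin n → ℝ) ≃ₗ[ℝ] (Fin n → ℝ)}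
    (hE : ∀ i, ∀ x ∈ F.V i, E x ∈ F.V i) (hE' : ∀ i, ∀ x ∈ F.V i, E.symm x ∈ F.V i)
    (hval : ∀ i x (hx : x ∈ F.V i.castSucc), F.value i (E x) (hE _ _ hx) = F.value i x hx) :
    matrixOfEquiv E ∈ F.isom := by
  refine ⟨fun i x => ?_, fun i x hx hgx => ?_⟩
  · rw [matrixOfEquiv_smul]
    exact ⟨fun h => by simpa using hE' i _ h, hE i x⟩
  · rw [value_congr (matrixOfEquiv_smul E x) hgx (hE _ _ hx), hval]

/-- A reflection in an anisotropic vector `u` of `V i / V (i + 1)`, extended arbitrarily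
to `ℝⁿ`. -/
theorem reflection_mem_isom {i : Fin (F.k + 1)} {φ : Module.Dual ℝ (Fin n → ℝ)}
    (u : F.V i.castSucc) (hu : F.form i (F.quot i u) ≠ 0) (h2 : φ u = 2)
    (hφ : ∀ x : F.V i.castSucc,
      φ x * F.form i (F.quot i u) = polar (F.form i) (F.quot i x) (F.quot i u)) :
    matrixOfEquiv (Module.reflection h2) ∈ F.isom := by
  have h0 : ∀ x ∈ F.V i.succ, φ x = 0 := by
    intro x hx
    have hx' : x ∈ F.V i.castSucc := F.V_le Fin.castSucc_lt_succ.le hx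
    have h1 := hφ ⟨x, hx'⟩
    rw [(F.quot_eq_zero_iff ⟨x, hx'⟩).2 hx, polar_zero_left] at h1
    exact (mul_eq_zero.1 h1).resolve_right hu
  have hmem : ∀ j, ∀ x ∈ F.V j, Module.reflection h2 x ∈ F.V j := by
    intro j x hx
    rw [Module.reflection_apply]
    rcases lt_or_ge i.castSucc j with h | h
    · rwa [h0 x (F.V_le (Fin.castSucc_lt_iff_succ_le.1 h) hx), zero_smul, sub_zero]
    · exact Submodule.sub_mem _ hx (Submodule.smul_mem _ _ (F.V_le h u.2))
  refine F.matrixOfEquiv_mem_isom hmem hmem fun j x hx => ?_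
  rcases lt_trichotomy j i with h | rfl | h
  · refine F.value_eq_of_sub_mem _ _ ?_
    rw [Module.reflection_apply, sub_sub_cancel_left]
    exact neg_mem (Submodule.smul_mem _ _ (F.V_le (Fin.succ_le_castSucc_iff.2 h) u.2))
  · have h3 : F.quot j ⟨_, hmem _ _ hx⟩ =
        F.quot j ⟨x, hx⟩ + (-φ x) • F.quot j u := by
      rw [← map_smul, ← map_add]
      congr 1
      ext1
      simp [Module.reflection_apply, sub_eq_add_neg]
    rw [value_eq_form_quot, value_eq_form_quot, h3, QuadraticMap.map_add (F.form j),
      QuadraticMap.map_smul, polar_smul_right, ← hφ ⟨x, hx⟩, smul_eq_mul, smul_eq_mul]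
    ring
  · refine F.value_eq_of_sub_mem _ _ ?_
    rw [Module.reflection_apply, h0 x (F.V_le (Fin.succ_le_castSucc_iff.2 h) hx), zero_smul,
      sub_zero, sub_self]
    exact zero_mem _

/-- Every anisotropic vector of `V i / V (i + 1)` gives a reflection in `F.isom`. -/
theorem exists_reflection {i : Fin (F.k + 1)} (u : F.V i.castSucc)
    (hu : F.form i (F.quot i u) ≠ 0) :
    ∃ (φ : Module.Dual ℝ (Fin n → ℝ)) (h2 : φ u = 2),
      (∀ x : F.V i.castSucc,
        φ x * F.form i (F.quot i u) = polar (F.form i) (F.quot i x) (F.quot i u)) ∧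
      matrixOfEquiv (Module.reflection h2) ∈ F.isom := by
  obtain ⟨φ, hφ⟩ := LinearMap.exists_extend ((F.form i (F.quot i u))⁻¹ •
    ((polarBilin (F.form i)).flip (F.quot i u)).comp (F.quot i))
  have hφ' : ∀ x : F.V i.castSucc,
      φ x = (F.form i (F.quot i u))⁻¹ * polar (F.form i) (F.quot i x) (F.quot i u) := fun x =>
    LinearMap.congr_fun hφ x
  have h1 : ∀ x : F.V i.castSucc,
      φ x * F.form i (F.quot i u) = polar (F.form i) (F.quot i x) (F.quot i u) := by
    intro x
    rw [hφ' x]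
    field_simp
  have h2 : φ u = 2 := by
    have := h1 u
    rw [polar_self, nsmul_eq_mul, Nat.cast_ofNat] at this
    exact mul_right_cancel₀ hu this
  exact ⟨φ, h2, h1, F.reflection_mem_isom u hu h2 h1⟩

/-! ### Partial flags of forms define subgeometries -/

/-- The first form `form 0`, as a degenerate form on `ℝⁿ`. -/
def headForm : QuadraticForm ℝ (Fin n → ℝ) :=
  (F.form 0).comp ((F.quot 0).comp (LinearMap.codRestrict _ LinearMap.id F.mem_V_zero))

theorem domain_eq_negativeLines : F.domain = negativeLines F.headForm := rfl

theorem headForm_smul {g : GL (Fin n) ℝ} (hg : g ∈ F.isom) (x : Fin n → ℝ) :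
    F.headForm (g • x) = F.headForm x :=
  hg.2 0 x _ _

theorem smul_mem_domain {g : PGL(Fin n, ℝ)} (hg : g ∈ F.pIsom) {x : ℙ ℝ (Fin n → ℝ)}
    (hx : x ∈ F.domain) : g • x ∈ F.domain := by
  obtain ⟨G, hG, rfl⟩ := hg
  induction x using Projectivization.ind with
  | h v hv =>
  rw [domain_eq_negativeLines, mk_mem_negativeLines_iff] at hx
  rw [domain_eq_negativeLines, Projectivization.PGL.mk_smul_mk, mk_mem_negativeLines_iff,
    F.headForm_smul hG]
  exact hx

/-- Vectors `x` and `y` on which the first form takes the same value are exchanged by the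
reflection in `x - y`, when this vector is anisotropic. -/
theorem exists_smul_eq_of_headForm_eq {x y : Fin n → ℝ} (hxy : F.headForm x = F.headForm y)
    (h : F.headForm (x - y) ≠ 0) : ∃ g ∈ F.isom, g • x = y := by
  let c : (Fin n → ℝ) → F.V (0 : Fin (F.k + 1)).castSucc := fun z => ⟨z, F.mem_V_zero z⟩
  obtain ⟨φ, h2, hφ, hg⟩ := F.exists_reflection (c (x - y)) h
  refine ⟨_, hg, ?_⟩
  have h1 : φ x = 1 := by
    have h3 : φ x * F.headForm (x - y) = polar F.headForm x (x - y) := hφ (c x)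
    have h4 : polar F.headForm x (x - y) = F.headForm (x - y) := by
      rw [sub_eq_add_neg, polar_add_right, polar_self, polar_neg_right,
        QuadraticMap.map_add F.headForm, polar_neg_right, QuadraticMap.map_neg, hxy, two_nsmul]
    rw [h4] at h3
    exact mul_right_cancel₀ h (h3.trans (one_mul _).symm)
  rw [matrixOfEquiv_smul, Module.reflection_apply, h1, one_smul]
  exact sub_sub_cancel x y

theorem exists_smul_eq_of_mem_domain {x y : ℙ ℝ (Fin n → ℝ)} (hx : x ∈ F.domain)
    (hy : y ∈ F.domain) : ∃ g ∈ F.pIsom, g • x = y := by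
  induction x using Projectivization.ind with
  | h v hv =>
  induction y using Projectivization.ind with
  | h w hw =>
  rw [domain_eq_negativeLines, mk_mem_negativeLines_iff] at hx hy
  -- rescale `w` so that the two values agree; then reflect in `v - w` or in `v + w`
  set t := Real.sqrt (F.headForm v / F.headForm w) with ht
  have hpos : 0 < F.headForm v / F.headForm w := div_pos_of_neg_of_neg hx hy
  have ht0 : t ≠ 0 := (Real.sqrt_pos.2 hpos).ne'
  have hval : F.headForm (t • w) = F.headForm v := by
    rw [QuadraticMap.map_smul, ht, Real.mul_self_sqrt hpos.le, smul_eq_mul,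
      div_mul_cancel₀ _ hy.ne]
  suffices h : ∃ (c : ℝ) (_ : c ≠ 0), ∃ g ∈ F.isom, g • v = c • w by
    obtain ⟨c, hc, g, hg, hgv⟩ := h
    refine ⟨_, ⟨g, hg, rfl⟩, ?_⟩
    rw [Projectivization.PGL.mk_smul_mk]
    exact (Projectivization.mk_eq_mk_iff' ℝ _ _ _ _).2 ⟨c, hgv.symm⟩
  -- the values at `v - w` and at `v + w` add up to four times the value at `v`
  by_cases h : F.headForm (v - t • w) = 0
  · refine ⟨-t, neg_ne_zero.2 ht0, ?_⟩
    rw [neg_smul]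
    refine F.exists_smul_eq_of_headForm_eq (by rw [QuadraticMap.map_neg, hval]) ?_
    intro h'
    have h1 : F.headForm (v - -(t • w)) + F.headForm (v - t • w) = 4 * F.headForm v := by
      rw [sub_neg_eq_add, sub_eq_add_neg, QuadraticMap.map_add F.headForm,
        QuadraticMap.map_add F.headForm, polar_neg_right, QuadraticMap.map_neg, hval]
      ring
    rw [h, h'] at h1
    linarith
  · exact ⟨t, ht0, F.exists_smul_eq_of_headForm_eq hval.symm h⟩

theorem exists_headForm_neg (h : F.p 0 ≠ 0) : ∃ e, F.headForm e < 0 := by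
  obtain ⟨W, hW, hneg⟩ := exists_finrank_eq_sigNeg_and_negDef (F.form 0)
  have hW0 : 0 < Module.finrank ℝ W := by
    rw [hW]
    exact Nat.pos_of_ne_zero h
  obtain ⟨z, hz⟩ := Module.finrank_pos_iff_exists_ne_zero.1 hW0
  obtain ⟨⟨x, hx0⟩, hx⟩ := Submodule.mkQ_surjective _ z.1
  refine ⟨x, ?_⟩
  have h1 : F.headForm x = F.form 0 z := by
    rw [← hx]
    rfl
  have h2 : 0 < -F.form 0 z := hneg z hz
  rw [h1]
  exact neg_pos.1 h2

theorem isSubgeometry (hn : 0 < n) (h : F.p 0 ≠ 0) : IsSubgeometry F.domain F.pIsom := by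
  obtain ⟨e, he⟩ := F.exists_headForm_neg h
  exact ⟨F.isClosed_pIsom hn, isOpen_negativeLines F.headForm, isConnected_negativeLines he,
    fun g hg y hy => F.smul_mem_domain hg hy,
    fun y hy z hz => F.exists_smul_eq_of_mem_domain hy hz⟩

end PartialFlagOfForms

end Reflections

/-! ### A partial flag of forms is determined by its projective isometry group -/

section Uniqueness

open QuadraticMap

theorem exists_quadratic_ne_zero_and_linear_ne_zero {a a' : ℝ} (ha : a ≠ 0) (ha' : a' ≠ 0)
    (b c b' : ℝ) : ∃ t : ℝ, a * t ^ 2 + b * t + c ≠ 0 ∧ a' * t + b' ≠ 0 := by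
  open Polynomial in
  by_contra! h
  have h0 : (C a * X ^ 2 + C b * X + C c) * (C a' * X + C b') = 0 := by
    refine Polynomial.funext fun t => ?_
    simp only [eval_mul, eval_add, eval_pow, eval_X, eval_C, eval_zero, mul_eq_zero]
    by_cases h1 : a * t ^ 2 + b * t + c = 0
    · exact Or.inl h1
    · exact Or.inr (h t h1)
  rcases mul_eq_zero.1 h0 with h1 | h1
  · have := congrArg natDegree h1
    rw [natDegree_quadratic ha] at this
    simp at this
  · have := congrArg natDegree h1
    rw [natDegree_linear ha'] at this
    simp at this

/-- A quadratic form that is invariant under all the reflections of a nonzero form `Q` is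
proportional to `Q`. -/
theorem exists_eq_mul_of_reflection_invariant {M : Type*} [AddCommGroup M] [Module ℝ M]
    {Q Q' : QuadraticForm ℝ M} {u₀ : M} (hu₀ : Q u₀ ≠ 0)
    (h : ∀ u, Q u ≠ 0 → ∀ x, Q' (x - (polar Q x u / Q u) • u) = Q' x) :
    ∃ c : ℝ, ∀ x, Q' x = c * Q x := by
  have hexp : ∀ (R : QuadraticForm ℝ M) (x u : M) (t : ℝ),
      R (x + t • u) = R x + t * polar R x u + t * t * R u := by
    intro R x u t
    rw [QuadraticMap.map_add R, QuadraticMap.map_smul, polar_smul_right]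
    simp only [smul_eq_mul]
    ring
  -- invariance under the reflection in `u` compares the polar forms against `u`
  have hpol : ∀ u, Q u ≠ 0 → ∀ x, Q u * polar Q' x u = Q' u * polar Q x u := by
    intro u hu
    have h1 : ∀ x, polar Q x u ≠ 0 → Q u * polar Q' x u = Q' u * polar Q x u := by
      intro x hx
      have h2 := h u hu x
      rw [sub_eq_add_neg, ← neg_smul, hexp] at h2
      have h3 : polar Q x u / Q u ≠ 0 := div_ne_zero hx hu
      have h4 : polar Q' x u = polar Q x u / Q u * Q' u := by
        refine mul_left_cancel₀ h3 ?_
        linear_combination -h2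
      rw [h4]
      field_simp
    intro x
    by_cases hx : polar Q x u = 0
    · have h5 := h1 (x + u) (by
        rw [polar_add_left, hx, polar_self, zero_add, two_nsmul]
        intro h6
        exact hu (by linarith))
      rw [polar_add_left, polar_add_left, hx, polar_self, polar_self, two_nsmul, two_nsmul] at h5
      rw [hx]
      linear_combination h5
    · exact h1 x hx
  refine ⟨Q' u₀ / Q u₀, fun x => ?_⟩
  set c := Q' u₀ / Q u₀ with hc
  have hc' : Q' u₀ = c * Q u₀ := by rw [hc, div_mul_cancel₀ _ hu₀]
  have hpol₀ : ∀ x, polar Q' x u₀ = c * polar Q x u₀ := by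
    intro x
    refine mul_left_cancel₀ hu₀ ?_
    rw [hpol u₀ hu₀, hc']
    ring
  -- compare the two forms at an anisotropic vector of the line through `x` parallel to `u₀`
  obtain ⟨t, ht1, ht2⟩ := exists_quadratic_ne_zero_and_linear_ne_zero hu₀
    (mul_ne_zero two_ne_zero hu₀) (polar Q x u₀) (Q x) (polar Q x u₀)
  have hQu : Q (x + t • u₀) ≠ 0 := by
    rw [hexp]
    intro h0
    exact ht1 (by linear_combination h0)
  have hlin : polar Q u₀ (x + t • u₀) ≠ 0 := by
    rw [polar_comm, polar_add_left, polar_smul_left, polar_self, two_nsmul, smul_eq_mul]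
    intro h0
    exact ht2 (by linear_combination h0)
  have h1 := hpol _ hQu u₀
  rw [polar_comm Q', hpol₀, polar_comm Q _ u₀, ← mul_assoc] at h1
  have h2 := mul_right_cancel₀ hlin h1
  rw [hexp, hexp, hpol₀, hc'] at h2
  linear_combination -h2

variable {n : ℕ}

theorem mul_scalar_smul (g : GL (Fin n) ℝ) (u : ℝˣ) (x : Fin n → ℝ) :
    (g * Matrix.GeneralLinearGroup.scalar (Fin n) u) • x = (u : ℝ) • g • x := by
  rw [generalLinearGroup_smul_eq, coe_mul_scalar, Matrix.smul_mulVec]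
  rfl

namespace PartialFlagOfForms

theorem exists_form_ne_zero (F : PartialFlagOfForms n) (i : Fin (F.k + 1)) :
    ∃ z, F.form i z ≠ 0 := by
  by_contra! h
  have h1 : F.V i.castSucc ≤ F.V i.succ := by
    intro x hx
    rw [← F.quot_eq_zero_iff ⟨x, hx⟩]
    refine eq_zero_of_polar_eq_zero (F.nondegenerate i) fun y => ?_
    simp [polar, h]
  exact (F.strictAnti Fin.castSucc_lt_succ).not_ge h1

/-- The only subspaces invariant under the isometries of a partial flag of forms are the members
of the flag: if `W ≤ V t` is not contained in `V (t + 1)`, then the reflections of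
`V t / V (t + 1)`, which may be lifted to move vectors of `W` in the direction of arbitrary
anisotropic vectors of `V t`, show that `V t ≤ W`. -/
theorem eq_V_of_invariant (F : PartialFlagOfForms n) {W : Submodule ℝ (Fin n → ℝ)}
    (hW : ∀ g ∈ F.isom, ∀ x ∈ W, g • x ∈ W) : ∃ i, W = F.V i := by
  suffices h : ∀ i, W ≤ F.V i → ∃ j, W = F.V j from h 0 (F.V_zero ▸ le_top)
  intro i
  induction i using Fin.reverseInduction with
  | last => exact fun h => ⟨_, le_antisymm h (F.V_last ▸ bot_le)⟩
  | cast t ih =>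
    intro hle
    by_cases hle' : W ≤ F.V t.succ
    · exact ih hle'
    refine ⟨t.castSucc, le_antisymm hle ?_⟩
    obtain ⟨w, hwW, hw⟩ := SetLike.not_le_iff_exists.1 hle'
    set Q := F.form t with hQ
    set w' : F.V t.castSucc := ⟨w, hle hwW⟩ with hw'
    have hrefl : ∀ u : F.V t.castSucc, Q (F.quot t u) ≠ 0 →
        polar Q (F.quot t w') (F.quot t u) ≠ 0 → (u : Fin n → ℝ) ∈ W := by
      intro u hu hwu
      obtain ⟨φ, h2, hφ, hg⟩ := F.exists_reflection u hu
      have h3 := hW _ hg w hwW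
      rw [matrixOfEquiv_smul, Module.reflection_apply, Submodule.sub_mem_iff_right _ hwW] at h3
      have hφw : φ w ≠ 0 := by
        intro h0
        have h4 := hφ w'
        rw [show (w' : Fin n → ℝ) = w from rfl, h0, zero_mul] at h4
        exact hwu h4.symm
      exact (Submodule.smul_mem_iff _ hφw).1 h3
    -- an anisotropic vector that is not orthogonal to `w`
    obtain ⟨u₀, hu₀, hwu₀⟩ : ∃ u₀ : F.V t.castSucc, Q (F.quot t u₀) ≠ 0 ∧
        polar Q (F.quot t w') (F.quot t u₀) ≠ 0 := by
      by_cases hQw : Q (F.quot t w') = 0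
      · obtain ⟨y, hy⟩ : ∃ y, polar Q (F.quot t w') y ≠ 0 := by
          by_contra! h0
          exact hw ((F.quot_eq_zero_iff w').1
            (eq_zero_of_polar_eq_zero (F.nondegenerate t) h0))
        obtain ⟨v, rfl⟩ : ∃ v, F.quot t v = y := Submodule.mkQ_surjective _ y
        refine ⟨v + ((1 - Q (F.quot t v)) / polar Q (F.quot t w') (F.quot t v)) • w', ?_, ?_⟩
        · rw [_root_.map_add, _root_.map_smul, QuadraticMap.map_add Q, QuadraticMap.map_smul, hQw,
            polar_smul_right, polar_comm Q (F.quot t v), smul_zero, smul_eq_mul,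
            div_mul_cancel₀ _ hy]
          norm_num
        · rwa [_root_.map_add, _root_.map_smul, polar_add_right, polar_smul_right, polar_self, hQw,
            smul_zero, smul_zero, add_zero]
      · refine ⟨w', hQw, ?_⟩
        rw [polar_self, two_nsmul]
        intro h0
        exact hQw (by linarith)
    -- such vectors span `V t`: almost all the vectors `u + s u₀` are of this kind
    intro u hu
    obtain ⟨s, hs1, hs2⟩ := exists_quadratic_ne_zero_and_linear_ne_zero hu₀ hwu₀
      (polar Q (F.quot t ⟨u, hu⟩) (F.quot t u₀)) (Q (F.quot t ⟨u, hu⟩))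
      (polar Q (F.quot t w') (F.quot t ⟨u, hu⟩))
    have h1 : ((⟨u, hu⟩ + s • u₀ : F.V t.castSucc) : Fin n → ℝ) ∈ W := by
      refine hrefl _ ?_ ?_
      · rw [_root_.map_add, _root_.map_smul, QuadraticMap.map_add Q, QuadraticMap.map_smul,
          polar_smul_right, smul_eq_mul, smul_eq_mul]
        intro h0
        exact hs1 (by linear_combination h0)
      · rw [_root_.map_add, _root_.map_smul, polar_add_right, polar_smul_right, smul_eq_mul]
        intro h0
        exact hs2 (by linear_combination h0)
    have h2 := hrefl u₀ hu₀ hwu₀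
    have h3 := Submodule.sub_mem _ h1 (Submodule.smul_mem _ s h2)
    simpa using h3

theorem exists_V_eq_of_pIsom_le {F F' : PartialFlagOfForms n} (h : F.pIsom ≤ F'.pIsom)
    (i : Fin (F'.k + 2)) : ∃ j, F'.V i = F.V j := by
  refine F.eq_V_of_invariant fun g hg x hx => ?_
  obtain ⟨u, hu⟩ := mk_mem_map_iff.1 (h ⟨g, hg, rfl⟩ : Matrix.ProjGenLinGroup.mk g ∈ F'.pIsom)
  have h1 := (hu.1 i x).2 hx
  rw [mul_scalar_smul] at h1
  exact (Submodule.smul_mem_iff _ u.ne_zero).1 h1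

/-- The forms of two partial flags with the same subspaces are proportional if the isometries of the
first are, up to scalars, isometries of the second. The fields are kept unbundled so that both
families of forms live on the same quotient spaces. -/
theorem exists_form_eq_mul_of_pIsom_le {k : ℕ} {V : Fin (k + 2) → Submodule ℝ (Fin n → ℝ)}
    {h0 : V 0 = ⊤} {h1 : V (Fin.last (k + 1)) = ⊥} {h2 : StrictAnti V}
    {β β' : (i : Fin (k + 1)) →
      QuadraticForm ℝ (V i.castSucc ⧸ (V i.succ).submoduleOf (V i.castSucc))}
    {h3 : ∀ i, (β i).Nondegenerate} {h3' : ∀ i, (β' i).Nondegenerate}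
    (h : (⟨k, V, h0, h1, h2, β, h3⟩ : PartialFlagOfForms n).pIsom ≤
      (⟨k, V, h0, h1, h2, β', h3'⟩ : PartialFlagOfForms n).pIsom) (i : Fin (k + 1)) :
    ∃ c : ℝ, c ≠ 0 ∧ ∀ z, β' i z = c * β i z := by
  set F : PartialFlagOfForms n := ⟨k, V, h0, h1, h2, β, h3⟩ with hF
  set F' : PartialFlagOfForms n := ⟨k, V, h0, h1, h2, β', h3'⟩ with hF'
  obtain ⟨z₀, hz₀⟩ := F.exists_form_ne_zero i
  obtain ⟨z₁, hz₁⟩ := F'.exists_form_ne_zero i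
  have hsurj : Function.Surjective (F.quot i) := Submodule.mkQ_surjective _
  suffices hc : ∃ c : ℝ, ∀ z, β' i z = c * β i z by
    obtain ⟨c, hc⟩ := hc
    refine ⟨c, ?_, hc⟩
    rintro rfl
    exact hz₁ ((hc z₁).trans (zero_mul _))
  refine exists_eq_mul_of_reflection_invariant hz₀ fun u hu x => ?_
  obtain ⟨u, rfl⟩ := hsurj u
  obtain ⟨x, rfl⟩ := hsurj x
  obtain ⟨φ, hφu, hφ, hg⟩ := F.exists_reflection u hu
  obtain ⟨r, hr⟩ := mk_mem_map_iff.1 (h ⟨_, hg, rfl⟩ :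
    Matrix.ProjGenLinGroup.mk (matrixOfEquiv (Module.reflection hφu)) ∈ F'.pIsom)
  -- the reflection is an isometry of `F'` up to the factor `r`, and it is an involution
  have hrefl : ∀ y : F.V i.castSucc,
      (r : ℝ) * r * β' i (F.quot i (y - φ y • u)) = β' i (F.quot i y) := by
    intro y
    have h4 := (hr.1 i.castSucc y).2 y.2
    have h5 := hr.2 i y y.2 h4
    have h6 : (matrixOfEquiv (Module.reflection hφu) *
        Matrix.GeneralLinearGroup.scalar (Fin n) r) • (y : Fin n → ℝ) =
        (((r : ℝ) • (y - φ y • u) : F.V i.castSucc) : Fin n → ℝ) := by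
      rw [mul_scalar_smul, matrixOfEquiv_smul, Module.reflection_apply]
      rfl
    rw [value_congr h6 h4 ((r : ℝ) • (y - φ y • u) : F.V i.castSucc).2] at h5
    have h7 : β' i (F.quot i ((r : ℝ) • (y - φ y • u))) = β' i (F.quot i y) := h5
    rwa [_root_.map_smul, QuadraticMap.map_smul, smul_eq_mul] at h7
  have hinv : ∀ y : F.V i.castSucc, (y - φ y • u) - φ (y - φ y • u : F.V i.castSucc) • u = y := by
    intro y
    have h4 : φ (y - φ y • u : F.V i.castSucc) = -φ y := by
      rw [Submodule.coe_sub, Submodule.coe_smul, _root_.map_sub, _root_.map_smul, hφu, smul_eq_mul]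
      ring
    rw [h4]
    module
  have hr2 : (r : ℝ) * r = 1 := by
    obtain ⟨y, rfl⟩ := hsurj z₁
    have h4 := hrefl (y - φ y • u)
    rw [hinv, ← hrefl y, ← mul_assoc] at h4
    have h5 : β' i (F.quot i (y - φ y • u)) ≠ 0 := by
      intro h6
      have h7 := hrefl y
      rw [h6, mul_zero] at h7
      exact hz₁ h7.symm
    have h10 : ((r : ℝ) * r) ^ 2 = 1 := by
      refine mul_right_cancel₀ h5 ?_
      linear_combination h4
    nlinarith [mul_self_pos.2 r.ne_zero]
  have h4 := hrefl x
  rw [hr2, one_mul, _root_.map_sub, _root_.map_smul] at h4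
  convert h4 using 4
  rw [div_eq_iff hu]
  exact (hφ x).symm

end PartialFlagOfForms

theorem sig_of_eq_mul {M : Type*} [AddCommGroup M] [Module ℝ M]
    {Q Q' : QuadraticForm ℝ M} {c : ℝ} (h : ∀ z, Q' z = c * Q z) :
    (0 < c → sigNeg Q' = sigNeg Q ∧ sigPos Q' = sigPos Q) ∧
    (c < 0 → sigNeg Q' = sigPos Q ∧ sigPos Q' = sigNeg Q) := by
  have key : ∀ R : QuadraticForm ℝ M, ∀ a : ℝ, 0 < a → R.Equivalent (a • R) := by
    intro R a ha
    refine ⟨⟨LinearEquiv.smulOfNeZero ℝ M (Real.sqrt a)⁻¹ (by positivity), fun z => ?_⟩⟩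
    change a • R ((Real.sqrt a)⁻¹ • z) = R z
    rw [QuadraticMap.map_smul, smul_smul, ← mul_inv,
      Real.mul_self_sqrt ha.le, smul_eq_mul, mul_inv_cancel₀ ha.ne', one_mul]
  constructor
  · intro hc
    have : Q' = c • Q := by ext z; exact h z
    rw [this]
    exact ⟨(key Q c hc).sigNeg_eq.symm, (key Q c hc).sigPos_eq.symm⟩
  · intro hc
    have : Q' = (-c) • (-Q) := by
      ext z
      simp [h z]
    have e := key (-Q) (-c) (neg_pos.2 hc)
    rw [this, ← e.sigNeg_eq, ← e.sigPos_eq]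
    exact ⟨sigNeg_neg, sigPos_neg⟩

variable {n : ℕ}

/-- Partial flags of forms with the same projective isometry group have the same subspaces, and
their forms are proportional. -/
theorem PartialFlagOfForms.exists_mul_of_pIsom_eq {F F' : PartialFlagOfForms n}
    (h : F.pIsom = F'.pIsom) :
    ∃ hk : F.k + 1 = F'.k + 1, ∀ i : Fin (F.k + 1), ∃ c : ℝ, c ≠ 0 ∧
      (∀ x hx hx', F'.value (i.cast hk) x hx' = c * F.value i x hx) ∧
      (0 < c → F'.p (i.cast hk) = F.p i ∧ F'.q (i.cast hk) = F.q i) ∧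
      (c < 0 → F'.p (i.cast hk) = F.q i ∧ F'.q (i.cast hk) = F.p i) := by
  have hrange : Set.range F.V = Set.range F'.V := by
    refine Set.Subset.antisymm ?_ ?_
    · rintro _ ⟨i, rfl⟩
      obtain ⟨j, hj⟩ := exists_V_eq_of_pIsom_le h.ge i
      exact ⟨j, hj.symm⟩
    · rintro _ ⟨i, rfl⟩
      obtain ⟨j, hj⟩ := exists_V_eq_of_pIsom_le h.le i
      exact ⟨j, hj.symm⟩
  have hcard : F.k = F'.k := by
    have h1 := Set.ncard_range_of_injective F.strictAnti.injective
    have h2 := Set.ncard_range_of_injective F'.strictAnti.injective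
    rw [hrange, h2] at h1
    simpa using h1.symm
  obtain ⟨k, V, h0, h1, h2, β, h3⟩ := F
  obtain ⟨k', V', h0', h1', h2', β', h3'⟩ := F'
  dsimp only at hcard hrange
  subst hcard
  have hV : V = V' := by
    have := (StrictMono.range_inj (f := OrderDual.toDual ∘ V) (g := OrderDual.toDual ∘ V')
      h2.dual_right h2'.dual_right).1 (by rw [Set.range_comp, Set.range_comp, hrange])
    exact OrderDual.toDual.injective.comp_left this
  subst hV
  refine ⟨rfl, fun i => ?_⟩
  obtain ⟨c, hc, hβ⟩ := exists_form_eq_mul_of_pIsom_le h.le i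
  exact ⟨c, hc, fun x hx hx' => hβ _, (sig_of_eq_mul hβ).1, (sig_of_eq_mul hβ).2⟩

end Uniqueness

/-! ### Compactness: adapted coordinates for a sequence of quadratic forms -/

section Compactness

open Matrix QuadraticMap

variable {n : ℕ} {α : Type*}

theorem exists_tendsto_of_mem_Icc (U : Ultrafilter α) {a b : ℝ} {u : α → ℝ}
    (h : ∀ m, u m ∈ Set.Icc a b) : ∃ x ∈ Set.Icc a b, Tendsto u U (𝓝 x) := by
  obtain ⟨x, hx, hU⟩ := (isCompact_Icc (a := a) (b := b)).ultrafilter_le_nhds (U.map u)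
    (by rw [Filter.le_principal_iff]; exact Filter.mem_map.2 (Filter.univ_mem' h))
  exact ⟨x, hx, hU⟩

/-- Along an ultrafilter, finitely many sequences of positive numbers fall into finitely many
levels of magnitude: sequences of the same level are comparable, and sequences of a higher level
are negligible. -/
theorem exists_levels (hn : 0 < n) (U : Ultrafilter α) {v : α → Fin n → ℝ}
    (hv : ∀ m j, 0 < v m j) :
    ∃ (k : ℕ) (d : Fin n → Fin (k + 1)), Function.Surjective d ∧
      (∀ j l, d j < d l → Tendsto (fun m => v m l / v m j) U (𝓝 0)) ∧
      (∀ j l, d j = d l → ∃ ρ : ℝ, 0 < ρ ∧ Tendsto (fun m => v m l / v m j) U (𝓝 ρ)) := by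
  classical
  let N : Fin n → Fin n → Prop := fun l j => Tendsto (fun m => v m l / v m j) U (𝓝 0)
  let C : Fin n → Fin n → Prop := fun l j =>
    ∃ ρ : ℝ, 0 < ρ ∧ Tendsto (fun m => v m l / v m j) U (𝓝 ρ)
  have hv0 : ∀ m j, v m j ≠ 0 := fun m j => (hv m j).ne'
  -- the fractions `v l / (v l + v j)` converge in the compact interval `[0, 1]`
  have htri : ∀ l j, N l j ∨ N j l ∨ C l j := by
    intro l j
    obtain ⟨τ, ⟨hτ0, hτ1⟩, hτ⟩ := exists_tendsto_of_mem_Icc U (a := 0) (b := 1)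
      (u := fun m => v m l / (v m l + v m j)) (fun m => by
        have := hv m l
        have := hv m j
        constructor
        · positivity
        · rw [div_le_one (by positivity)]
          linarith)
    rcases hτ1.lt_or_eq with h1 | h1
    · have h2 : Tendsto (fun m => v m l / v m j) U (𝓝 (τ / (1 - τ))) := by
        refine (hτ.div (hτ.const_sub 1) (by linarith)).congr fun m => ?_
        have := hv m l
        have := hv m j
        have h3 : v m l + v m j ≠ 0 := by positivity
        have h4 : 1 - v m l / (v m l + v m j) = v m j / (v m l + v m j) := by
          field_simp
          ring
        simp only [Pi.div_apply]
        rw [h4]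
        field_simp
      rcases hτ0.lt_or_eq with h3 | h3
      · exact Or.inr (Or.inr ⟨_, div_pos h3 (by linarith), h2⟩)
      · rw [← h3, zero_div] at h2
        exact Or.inl h2
    · refine Or.inr (Or.inl ?_)
      have h2 : Tendsto (fun m => v m j / v m l) U (𝓝 ((1 - τ) / τ)) := by
        refine ((hτ.const_sub 1).div hτ (by linarith)).congr fun m => ?_
        have := hv m l
        have := hv m j
        have h3 : v m l + v m j ≠ 0 := by positivity
        have h4 : 1 - v m l / (v m l + v m j) = v m j / (v m l + v m j) := by
          field_simp
          ring
        simp only [Pi.div_apply]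
        rw [h4]
        field_simp
      rwa [h1, sub_self, zero_div] at h2
  have hmul : ∀ {l j a : Fin n} {x y : ℝ}, Tendsto (fun m => v m l / v m j) U (𝓝 x) →
      Tendsto (fun m => v m j / v m a) U (𝓝 y) →
      Tendsto (fun m => v m l / v m a) U (𝓝 (x * y)) := by
    intro l j a x y h1 h2
    refine (h1.mul h2).congr fun m => ?_
    have := hv0 m j
    have := hv0 m a
    field_simp
  have hone : ∀ (j : Fin n) {x : ℝ}, Tendsto (fun m => v m j / v m j) U (𝓝 x) → x = 1 := by
    intro j x h
    refine tendsto_nhds_unique h (tendsto_const_nhds.congr fun m => ?_)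
    rw [div_self (hv0 m j)]
  have hCsymm : ∀ l j, C l j → C j l := by
    rintro l j ⟨ρ, hρ, h⟩
    refine ⟨ρ⁻¹, inv_pos.2 hρ, (h.inv₀ hρ.ne').congr fun m => ?_⟩
    rw [inv_div]
  -- the level of a sequence is the number of sequences that dominate it
  let r : Fin n → ℕ := fun l => (Finset.univ.filter fun j => N l j).card
  have hrN : ∀ l j, N l j → r j < r l := by
    intro l j h
    refine Finset.card_lt_card ((Finset.ssubset_iff_of_subset ?_).2 ⟨j, ?_, ?_⟩)
    · intro a ha
      rw [Finset.mem_filter] at ha ⊢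
      have := hmul h ha.2
      rw [mul_zero] at this
      exact ⟨ha.1, this⟩
    · simpa using h
    · intro hj
      exact zero_ne_one (hone j (Finset.mem_filter.1 hj).2)
  have hrC : ∀ l j, C l j → r j = r l := by
    have hsub : ∀ l j, C l j → ∀ a, N j a → N l a := by
      rintro l j ⟨ρ, -, h⟩ a ha
      have := hmul h ha
      rwa [mul_zero] at this
    intro l j h
    refine congrArg Finset.card (Finset.filter_congr fun a _ => ?_)
    exact ⟨hsub l j h a, hsub j l (hCsymm l j h) a⟩
  have hlt : ∀ j l, r j < r l → N l j := by
    intro j l h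
    rcases htri l j with h1 | h1 | h1
    · exact h1
    · exact absurd (hrN j l h1) h.not_gt
    · exact absurd (hrC l j h1) h.ne
  have heq : ∀ j l, r j = r l → C l j := by
    intro j l h
    rcases htri l j with h1 | h1 | h1
    · exact absurd h (hrN l j h1).ne
    · exact absurd h (hrN j l h1).ne'
    · exact h1
  let s : Finset ℕ := Finset.univ.image r
  have hs : ∀ j, r j ∈ s := fun j => Finset.mem_image_of_mem r (Finset.mem_univ j)
  have hcard : s.card = (s.card - 1) + 1 :=
    (Nat.succ_pred_eq_of_pos (Finset.card_pos.2 ⟨_, hs ⟨0, hn⟩⟩)).symm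
  let e : Fin (s.card - 1 + 1) ≃o s := s.orderIsoOfFin hcard
  refine ⟨s.card - 1, fun j => e.symm ⟨r j, hs j⟩, fun i => ?_, fun j l h => ?_, fun j l h => ?_⟩
  · obtain ⟨j, -, hj⟩ := Finset.mem_image.1 (e i).2
    refine ⟨j, ?_⟩
    rw [OrderIso.symm_apply_eq]
    exact Subtype.ext hj
  · exact hlt j l (e.symm.lt_iff_lt.1 h)
  · exact heq j l (congrArg Subtype.val (e.symm.injective h))

/-- A nondegenerate form is diagonal in an orthonormal basis. -/
theorem exists_orthogonal_diagonal {β : QuadraticForm ℝ (Fin n → ℝ)} (hβ : β.Nondegenerate) :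
    ∃ (O : Matrix (Fin n) (Fin n) ℝ) (w : Fin n → ℝ), Oᵀ * O = 1 ∧ (∀ j, w j ≠ 0) ∧
      ∀ x, β (O *ᵥ x) = ∑ j, w j * x j ^ 2 := by
  have hA : (QuadraticForm.toMatrix' β).IsHermitian := by
    rw [Matrix.IsHermitian, Matrix.conjTranspose_eq_transpose_of_trivial]
    exact QuadraticForm.isSymm_toMatrix' β
  set O : Matrix (Fin n) (Fin n) ℝ := hA.eigenvectorUnitary.1 with hO
  set w := hA.eigenvalues with hw
  have hOO : Oᵀ * O = 1 := by
    have := Unitary.coe_star_mul_self hA.eigenvectorUnitary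
    rwa [Matrix.star_eq_conjTranspose, Matrix.conjTranspose_eq_transpose_of_trivial] at this
  have hspec : QuadraticForm.toMatrix' β = O * diagonal w * Oᵀ := by
    have := hA.spectral_theorem
    rw [Unitary.conjStarAlgAut_apply, Matrix.star_eq_conjTranspose,
      Matrix.conjTranspose_eq_transpose_of_trivial] at this
    exact this
  have hdiag : Oᵀ * QuadraticForm.toMatrix' β * O = diagonal w := by
    rw [hspec]
    calc Oᵀ * (O * diagonal w * Oᵀ) * O = (Oᵀ * O) * diagonal w * (Oᵀ * O) := by
          simp only [Matrix.mul_assoc]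
      _ = diagonal w := by rw [hOO, Matrix.one_mul, Matrix.mul_one]
  have hval : ∀ x, β (O *ᵥ x) = ∑ j, w j * x j ^ 2 := by
    intro x
    rw [quadraticForm_eq_dotProduct, ← dotProduct_diagonal_mulVec, ← hdiag, ← mulVec_mulVec,
      ← mulVec_mulVec, dotProduct_mulVec x, vecMul_transpose]
  refine ⟨O, w, hOO, fun j hj => ?_, hval⟩
  have h1 : O *ᵥ Pi.single j 1 = 0 := by
    refine eq_zero_of_polar_eq_zero hβ fun y => ?_
    have hy : O *ᵥ (Oᵀ *ᵥ y) = y := by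
      rw [mulVec_mulVec, mul_eq_one_comm.1 hOO, one_mulVec]
    rw [← hy, polar, ← mulVec_add, hval, hval, hval, ← Finset.sum_sub_distrib,
      ← Finset.sum_sub_distrib]
    refine Finset.sum_eq_zero fun a _ => ?_
    by_cases ha : a = j
    · subst ha
      rw [hj]
      ring
    · simp [ha]
  have h2 : Oᵀ *ᵥ (O *ᵥ (Pi.single j 1 : Fin n → ℝ)) = Pi.single j 1 := by
    rw [mulVec_mulVec, hOO, one_mulVec]
  rw [h1, mulVec_zero] at h2
  simpa using congrFun h2 j

/-- Along an ultrafilter, every sequence of nondegenerate forms of constant signature is diagonal in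
convergent coordinates, with coefficients `± s m i` on the coordinates of level `i`, where the
scales `s m i` of different levels are incommensurable. This uses the compactness of the orthogonal
group and of the set of ratios `[0, ∞]`. -/
theorem exists_adapted_coordinates (hn : 0 < n) (U : Ultrafilter α)
    {βm : α → QuadraticForm ℝ (Fin n → ℝ)} (hβ : ∀ m, (βm m).Nondegenerate) :
    ∃ (k : ℕ) (d : Fin n → Fin (k + 1)) (ε : Fin n → ℝ) (P : GL (Fin n) ℝ)
      (Pm : α → GL (Fin n) ℝ) (s : α → Fin (k + 1) → ℝ),
      Function.Surjective d ∧ (∀ j, ε j = 1 ∨ ε j = -1) ∧ Tendsto Pm U (𝓝 P) ∧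
      (∀ m i, 0 < s m i) ∧
      (∀ i i', i < i' → Tendsto (fun m => s m i' / s m i) U (𝓝 0)) ∧
      ∀ᶠ m in U, ∀ x, βm m (Pm m • x) = ∑ j, ε j * s m (d j) * x j ^ 2 := by
  choose O w hO hw hOw using fun m => exists_orthogonal_diagonal (hβ m)
  obtain ⟨k, d, hd, hlt, heq⟩ := exists_levels hn U (v := fun m j => |w m j|)
    (fun m j => abs_pos.2 (hw m j))
  -- the orthogonal matrices converge
  have hOb : ∀ m i j, O m i j ∈ Set.Icc (-1 : ℝ) 1 := by
    intro m i j
    have h1 := congrFun (congrFun (hO m) j) j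
    rw [Matrix.mul_apply, Matrix.one_apply_eq] at h1
    have h2 : O m i j * O m i j ≤ ∑ a, (O m)ᵀ j a * O m a j :=
      Finset.single_le_sum (f := fun a => (O m)ᵀ j a * O m a j)
        (fun a _ => mul_self_nonneg (O m a j)) (Finset.mem_univ i)
    rw [h1] at h2
    exact abs_le.1 (abs_le_one_iff_mul_self_le_one.2 h2)
  choose O' _ hO'lim using fun i j => exists_tendsto_of_mem_Icc U (fun m => hOb m i j)
  have hOlim : Tendsto O U (𝓝 (Matrix.of O')) :=
    tendsto_pi_nhds.2 fun i => tendsto_pi_nhds.2 fun j => hO'lim i j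
  have hO' : (Matrix.of O')ᵀ * Matrix.of O' = 1 := by
    refine tendsto_nhds_unique
      (((continuous_id.matrix_transpose.tendsto _).comp hOlim).mul hOlim) ?_
    refine tendsto_const_nhds.congr fun m => ?_
    exact (hO m).symm
  -- the signs are eventually constant
  have hsign : ∀ j, ∃ e : ℝ, (e = 1 ∨ e = -1) ∧ ∀ᶠ m in U, w m j = e * |w m j| := by
    intro j
    rcases U.em (fun m => 0 < w m j) with h | h
    · refine ⟨1, Or.inl rfl, h.mono fun m hm => ?_⟩
      rw [abs_of_pos hm, one_mul]
    · refine ⟨-1, Or.inr rfl, h.mono fun m hm => ?_⟩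
      rw [abs_of_nonpos (not_lt.1 hm)]
      ring
  choose ε hε hεw using hsign
  let rep : Fin (k + 1) → Fin n := Function.surjInv hd
  have hrep : ∀ i, d (rep i) = i := Function.surjInv_eq hd
  choose ρ hρ hρlim using fun j => heq (rep (d j)) j (hrep _)
  let μ : α → Fin n → ℝ := fun m j => |w m j| / |w m (rep (d j))|
  have hμ : ∀ m j, 0 < μ m j := fun m j => div_pos (abs_pos.2 (hw m j)) (abs_pos.2 (hw m _))
  -- rescale the orthonormal basis to make the coefficients of each level equal up to sign
  let M : α → Matrix (Fin n) (Fin n) ℝ := fun m => O m * diagonal fun j => (Real.sqrt (μ m j))⁻¹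
  let M' : Matrix (Fin n) (Fin n) ℝ := Matrix.of O' * diagonal fun j => (Real.sqrt (ρ j))⁻¹
  have hdet : ∀ {A : Matrix (Fin n) (Fin n) ℝ} {t : Fin n → ℝ}, Aᵀ * A = 1 → (∀ j, 0 < t j) →
      (A * diagonal fun j => (Real.sqrt (t j))⁻¹).det ≠ 0 := by
    intro A t hA ht
    rw [det_mul, det_diagonal]
    refine mul_ne_zero (fun h0 => ?_)
      (Finset.prod_ne_zero_iff.2 fun j _ => inv_ne_zero (Real.sqrt_pos.2 (ht j)).ne')
    have := congrArg det hA
    rw [det_mul, h0, mul_zero, det_one] at this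
    exact zero_ne_one this
  refine ⟨k, d, ε, GeneralLinearGroup.mkOfDetNeZero M' (hdet hO' hρ),
    fun m => GeneralLinearGroup.mkOfDetNeZero (M m) (hdet (hO m) (hμ m)),
    fun m i => |w m (rep i)|, hd, hε, ?_, fun m i => abs_pos.2 (hw m _), ?_, ?_⟩
  · refine tendsto_generalLinearGroup ?_
    change Tendsto M U (𝓝 M')
    refine hOlim.mul ((continuous_id.matrix_diagonal.tendsto _).comp ?_)
    exact tendsto_pi_nhds.2 fun j => (hρlim j).sqrt.inv₀ (Real.sqrt_pos.2 (hρ j)).ne'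
  · intro i i' h
    refine hlt _ _ ?_
    rwa [hrep, hrep]
  · filter_upwards [(eventually_all (p := fun j m => w m j = ε j * |w m j|)).2 hεw] with m hm x
    change βm m (M m *ᵥ x) = _
    simp only [M]
    rw [← mulVec_mulVec, hOw]
    refine Finset.sum_congr rfl fun j _ => ?_
    have h1 : |w m (rep (d j))| ≠ 0 := abs_ne_zero.2 (hw m _)
    have h2 : |w m j| ≠ 0 := abs_ne_zero.2 (hw m _)
    rw [mulVec_diagonal, mul_pow, inv_pow, Real.sq_sqrt (hμ m j).le, inv_div]
    nth_rewrite 1 [hm j]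
    field_simp

end Compactness

/-! ### Conjugacy limits of the geometry of a nondegenerate form -/

section ConjugacyLimits

open Matrix QuadraticMap

variable {n : ℕ}

/-- The form `x ↦ β (g⁻¹ x)`. -/
noncomputable def transportForm (β : QuadraticForm ℝ (Fin n → ℝ)) (g : GL (Fin n) ℝ) :
    QuadraticForm ℝ (Fin n → ℝ) :=
  β.comp (Matrix.mulVecLin (g⁻¹ : GL (Fin n) ℝ).1)

theorem transportForm_apply (β : QuadraticForm ℝ (Fin n → ℝ)) (g : GL (Fin n) ℝ)
    (x : Fin n → ℝ) : transportForm β g x = β (g⁻¹ • x) := rfl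

theorem transportForm_nondegenerate {β : QuadraticForm ℝ (Fin n → ℝ)} (hβ : β.Nondegenerate)
    (g : GL (Fin n) ℝ) : (transportForm β g).Nondegenerate := by
  refine nondegenerate_of_polar fun x hx => ?_
  have h : g⁻¹ • x = 0 := by
    refine eq_zero_of_polar_eq_zero hβ fun y => ?_
    have := hx (g • y)
    rw [polar, transportForm_apply, transportForm_apply, transportForm_apply, smul_add,
      inv_smul_smul] at this
    exact this
  rwa [smul_eq_zero_iff_eq] at h

theorem transportForm_equivalent (β : QuadraticForm ℝ (Fin n → ℝ)) (g : GL (Fin n) ℝ) :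
    (transportForm β g).Equivalent β :=
  ⟨⟨LinearMap.GeneralLinearGroup.generalLinearEquiv ℝ _ (Matrix.GeneralLinearGroup.toLin g⁻¹),
    fun _ => rfl⟩⟩

theorem map_conj_formPIsom (β : QuadraticForm ℝ (Fin n → ℝ)) (g : GL (Fin n) ℝ) :
    (formPIsom β).map (MulAut.conj (Matrix.ProjGenLinGroup.mk g)).toMonoidHom =
      formPIsom (transportForm β g) := by
  ext x
  constructor
  · rintro ⟨_, ⟨a, ha, rfl⟩, rfl⟩
    refine ⟨g * a * g⁻¹, fun y => ?_, ?_⟩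
    · rw [transportForm_apply, transportForm_apply, mul_smul, mul_smul, inv_smul_smul]
      exact ha _
    · simp
  · rintro ⟨a, ha, rfl⟩
    refine ⟨_, ⟨g⁻¹ * a * g, fun y => ?_, rfl⟩, ?_⟩
    · have := ha (g • y)
      rwa [transportForm_apply, transportForm_apply, inv_smul_smul, smul_smul, smul_smul] at this
    · simp [mul_assoc]

theorem image_smul_negativeLines (β : QuadraticForm ℝ (Fin n → ℝ)) (g : GL (Fin n) ℝ) :
    (fun y => Matrix.ProjGenLinGroup.mk g • y) '' negativeLines β =
      negativeLines (transportForm β g) := by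
  ext x
  rw [Set.image_smul, Set.mem_smul_set_iff_inv_smul_mem, ← map_inv]
  induction x using Projectivization.ind with
  | h v hv =>
  rw [Projectivization.PGL.mk_smul_mk, mk_mem_negativeLines_iff, mk_mem_negativeLines_iff]
  rfl

namespace PartialFlagOfForms

variable {F : PartialFlagOfForms n} {P : GL (Fin n) ℝ} {d : Fin n → Fin (F.k + 1)}
  {ε : Fin n → ℝ}

theorem IsAdapted.headForm_smul_eq (h : F.IsAdapted P d ε) (x : Fin n → ℝ) :
    F.headForm (P • x) = ∑ j, if d j = 0 then ε j * x j ^ 2 else 0 :=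
  h.value_eq 0 x (F.mem_V_zero _)

variable {α : Type*} {f : Filter α} {s : α → Fin (F.k + 1) → ℝ} {Pm : α → GL (Fin n) ℝ}

/-- After rescaling, the forms converge to the first form of the partial flag. -/
theorem IsAdapted.tendsto_headForm (h : F.IsAdapted P d ε) (hs : ∀ m i, s m i ≠ 0)
    (hlim : ∀ i i', i < i' → Tendsto (fun m => s m i' / s m i) f (𝓝 0))
    (hP : Tendsto Pm f (𝓝 P)) (x : Fin n → ℝ) :
    Tendsto (fun m => diagonalForm (Pm m) (fun j => ε j * s m (d j)) x / s m 0) f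
      (𝓝 (F.headForm x)) := by
  obtain ⟨y, rfl⟩ : ∃ y, x = P • y := ⟨P⁻¹ • x, by rw [smul_inv_smul]⟩
  rw [h.headForm_smul_eq]
  have hval : ∀ m, diagonalForm (Pm m) (fun j => ε j * s m (d j)) (P • y) / s m 0 =
      ∑ j, ε j * (s m (d j) / s m 0) * ((Pm m)⁻¹ • P • y) j ^ 2 := by
    intro m
    conv_lhs => rw [← smul_inv_smul (Pm m) (P • y)]
    rw [diagonalForm_apply_smul, Finset.sum_div]
    exact Finset.sum_congr rfl fun j _ => by ring
  simp_rw [hval]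
  refine tendsto_finsetSum _ fun j _ => ?_
  have hy : Tendsto (fun m => ((Pm m)⁻¹ • P • y) j) f (𝓝 (y j)) := by
    have h1 : Tendsto (fun m => ((Pm m)⁻¹).1 *ᵥ (P • y)) f (𝓝 ((P⁻¹).1 *ᵥ (P • y))) := by
      have hc : Continuous fun A : Matrix (Fin n) (Fin n) ℝ => A *ᵥ (P • y) :=
        continuous_id.matrix_mulVec continuous_const
      exact (hc.tendsto _).comp ((Units.continuous_val.tendsto _).comp hP.inv)
    have h2 : P⁻¹.1 *ᵥ (P • y) = y := inv_smul_smul P y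
    rw [h2] at h1
    exact h1.apply_nhds j
  split_ifs with hj
  · have : ∀ m, s m (d j) / s m 0 = 1 := fun m => by rw [hj, div_self (hs m 0)]
    simp only [this, mul_one]
    exact (hy.pow 2).const_mul _
  · have h1 := ((hlim 0 (d j) (Fin.pos_of_ne_zero hj)).const_mul (ε j)).mul (hy.pow 2)
    rwa [mul_zero, zero_mul] at h1

/-- An open set of lines on which the group of a partial flag of forms acts transitively is not
contained in the null cone of its first form. -/
theorem headForm_ne_zero_of_isSubgeometry {Z : Set (ℙ ℝ (Fin n → ℝ))}
    (hZ : IsSubgeometry Z F.pIsom) {v : Fin n → ℝ} (hv : v ≠ 0)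
    (hvZ : Projectivization.mk ℝ v hv ∈ Z) : F.headForm v ≠ 0 := by
  intro h0
  have hnull : ∀ (w : Fin n → ℝ) (hw : w ≠ 0), Projectivization.mk ℝ w hw ∈ Z →
      F.headForm w = 0 := by
    intro w hw hwZ
    obtain ⟨_, ⟨g, hg, rfl⟩, hgw⟩ := hZ.transitive _ hvZ _ hwZ
    rw [Projectivization.PGL.mk_smul_mk, Projectivization.mk_eq_mk_iff'] at hgw
    obtain ⟨a, ha⟩ := hgw
    have h1 := F.headForm_smul hg v
    rw [h0, ← ha, QuadraticMap.map_smul, smul_eq_mul, mul_eq_zero] at h1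
    refine h1.resolve_left fun h2 => ?_
    rw [mul_self_eq_zero.1 h2, zero_smul] at ha
    exact hv ((smul_eq_zero_iff_eq g).1 ha.symm)
  obtain ⟨e, he⟩ : ∃ e, F.headForm e ≠ 0 := by
    obtain ⟨z, hz⟩ := F.exists_form_ne_zero 0
    obtain ⟨⟨x, hx0⟩, rfl⟩ := Submodule.mkQ_surjective _ z
    exact ⟨x, hz⟩
  -- the first form vanishes on an interval of the affine line `v + t e`
  let T : Set {w : Fin n → ℝ // w ≠ 0} := {w | Projectivization.mk ℝ w.1 w.2 ∈ Z}
  have hT : IsOpen T := isOpen_coinduced.1 hZ.isOpen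
  have hO : IsOpen (Subtype.val '' T) := isOpen_ne.isOpenMap_subtype_val T hT
  have hline : IsOpen ((fun t : ℝ => v + t • e) ⁻¹' (Subtype.val '' T)) :=
    hO.preimage (by fun_prop)
  have h0mem : (0 : ℝ) ∈ (fun t : ℝ => v + t • e) ⁻¹' (Subtype.val '' T) :=
    ⟨⟨v, hv⟩, hvZ, by simp⟩
  obtain ⟨δ, hδ, hball⟩ := Metric.isOpen_iff.1 hline 0 h0mem
  have hval : ∀ t : ℝ, |t| < δ → t * polar F.headForm v e + t * t * F.headForm e = 0 := by
    intro t ht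
    obtain ⟨w, hw, hwt⟩ := hball (by simpa using ht : t ∈ Metric.ball (0 : ℝ) δ)
    have h1 := hnull w.1 w.2 hw
    rw [hwt, QuadraticMap.map_add F.headForm, h0, QuadraticMap.map_smul, polar_smul_right,
      smul_eq_mul, smul_eq_mul] at h1
    linarith
  have h1 := hval (δ / 2) (by rw [abs_of_pos (by positivity)]; linarith)
  have h2 := hval (-(δ / 2)) (by rw [abs_neg, abs_of_pos (by positivity)]; linarith)
  have h3 : δ * δ * F.headForm e = 0 := by linear_combination 2 * h1 + 2 * h2
  exact mul_ne_zero (mul_pos hδ hδ).ne' he h3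

/-- A set on which the group of a partial flag of forms acts transitively is the domain of the flag
as soon as it meets this domain, since both are orbits. -/
theorem eq_domain_of_isSubgeometry {Z : Set (ℙ ℝ (Fin n → ℝ))}
    (hZ : IsSubgeometry Z F.pIsom) {z : ℙ ℝ (Fin n → ℝ)} (hzZ : z ∈ Z) (hz : z ∈ F.domain) :
    Z = F.domain := by
  ext x
  constructor
  · intro hx
    obtain ⟨g, hg, rfl⟩ := hZ.transitive z hzZ x hx
    exact F.smul_mem_domain hg hz
  · intro hx
    obtain ⟨g, hg, rfl⟩ := F.exists_smul_eq_of_mem_domain hz hx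
    exact hZ.smul_mem g hg z hzZ

/-- Exchanging the signature of the forms of some levels amounts to changing the signs of these
levels. -/
theorem IsAdapted.sum_p_eq (h : F.IsAdapted P d ε) (S : Finset (Fin (F.k + 1))) :
    (∑ i, if i ∈ S then F.q i else F.p i) =
      ∑ j, if (if d j ∈ S then -ε j else ε j) < 0 then 1 else 0 := by
  simp_rw [h.p_eq, h.q_eq]
  have : ∀ i, (if i ∈ S then ∑ j, (if d j = i then (if 0 < ε j then 1 else 0) else 0) else
      ∑ j, if d j = i then (if ε j < 0 then 1 else 0) else 0) =
      ∑ j, if d j = i then (if (if d j ∈ S then -ε j else ε j) < 0 then 1 else 0) else 0 := by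
    intro i
    split_ifs with hi
    · refine Finset.sum_congr rfl fun j _ => ?_
      by_cases hj : d j = i
      · simp [hj, hi]
      · simp [hj]
    · refine Finset.sum_congr rfl fun j _ => ?_
      by_cases hj : d j = i
      · simp [hj, hi]
      · simp [hj]
  simp_rw [this]
  rw [Finset.sum_comm]
  simp

theorem IsAdapted.sum_q_eq (h : F.IsAdapted P d ε) (S : Finset (Fin (F.k + 1))) :
    (∑ i, if i ∈ S then F.p i else F.q i) =
      ∑ j, if 0 < (if d j ∈ S then -ε j else ε j) then 1 else 0 := by
  simp_rw [h.p_eq, h.q_eq]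
  have : ∀ i, (if i ∈ S then ∑ j, (if d j = i then (if ε j < 0 then 1 else 0) else 0) else
      ∑ j, if d j = i then (if 0 < ε j then 1 else 0) else 0) =
      ∑ j, if d j = i then (if 0 < (if d j ∈ S then -ε j else ε j) then 1 else 0) else 0 := by
    intro i
    split_ifs with hi
    · refine Finset.sum_congr rfl fun j _ => ?_
      by_cases hj : d j = i
      · simp [hj, hi]
      · simp [hj]
    · refine Finset.sum_congr rfl fun j _ => ?_
      by_cases hj : d j = i
      · simp [hj, hi]
      · simp [hj]
  simp_rw [this]
  rw [Finset.sum_comm]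
  simp

theorem IsAdapted.sum_sig_eq (h : F.IsAdapted P d ε) :
    ∑ i, F.p i = (∑ j, if ε j < 0 then 1 else 0) ∧ ∑ i, F.q i = ∑ j, if 0 < ε j then 1 else 0 :=
  ⟨by simpa using h.sum_p_eq ∅, by simpa using h.sum_q_eq ∅⟩

end PartialFlagOfForms

/-- Every conjugacy limit of the geometry of a nondegenerate form is the geometry of a partial
flag of forms whose signatures add up to the signature of the form. -/
theorem exists_flag_of_isConjugacyLimit (hn : 0 < n) {β : QuadraticForm ℝ (Fin n → ℝ)}
    (hβ : β.Nondegenerate) {Z : Set (ℙ ℝ (Fin n → ℝ))} {L : Subgroup PGL(Fin n, ℝ)}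
    (h : IsConjugacyLimit (negativeLines β) (formPIsom β) Z L) :
    ∃ F : PartialFlagOfForms n, Z = F.domain ∧ L = F.pIsom ∧
      ∑ i, F.p i = sigNeg β ∧ ∑ i, F.q i = sigPos β := by
  classical
  obtain ⟨-, hZL, c, ⟨hlimL, haccL⟩, z, hzZ, hzY⟩ := h
  choose g hg using fun m => Matrix.ProjGenLinGroup.mk_surjective (c m)
  simp_rw [← hg, map_conj_formPIsom] at hlimL haccL
  simp_rw [← hg, image_smul_negativeLines] at hzY
  let U : Ultrafilter ℕ := hyperfilter ℕ
  have hU : (U : Filter ℕ) ≤ atTop := Nat.hyperfilter_le_atTop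
  obtain ⟨k, d, ε, P, Pm, s, hd, hε, hP, hs, hlim, hev⟩ :=
    exists_adapted_coordinates hn U fun m => transportForm_nondegenerate hβ (g m)
  have hε0 : ∀ j, ε j ≠ 0 := fun j => by rcases hε j with h | h <;> rw [h] <;> norm_num
  let F := PartialFlagOfForms.ofCoordinates P hd hε0
  have hF : F.IsAdapted P d ε := PartialFlagOfForms.ofCoordinates_isAdapted P hd hε hε0
  have hs0 : ∀ m i, s m i ≠ 0 := fun m i => (hs m i).ne'
  -- replace the forms by diagonal ones, to which they are eventually equal
  let D : ℕ → QuadraticForm ℝ (Fin n → ℝ) := fun m => diagonalForm (Pm m) fun j => ε j * s m (d j)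
  have hD : ∀ m x, D m (Pm m • x) = ∑ j, ε j * s m (d j) * x j ^ 2 := fun m x =>
    diagonalForm_apply_smul _ _ _
  have hDev : ∀ᶠ m in U, transportForm β (g m) = D m := by
    filter_upwards [hev] with m hm
    ext x
    rw [← smul_inv_smul (Pm m) x, hm, hD]
  have hL : L = F.pIsom := by
    ext a
    constructor
    · intro ha
      obtain ⟨b, hb, hba⟩ := hlimL a ha
      refine hF.mem_pIsom_of_tendsto hn hs0 hlim hP hD
        (hm := fun m => if transportForm β (g m) = D m then b m else 1) (fun m => ?_)
        ((hba.mono_left hU).congr' ?_)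
      · split_ifs with hm
        · rw [← hm]
          exact hb m
        · exact one_mem _
      · filter_upwards [hDev] with m hm
        rw [if_pos hm]
    · intro ha
      obtain ⟨b, hb, hba⟩ := hF.exists_tendsto_of_mem_pIsom hs0 hlim hP hD ha
      refine haccL (fun m => if transportForm β (g m) = D m then b m else 1) (fun m => ?_) a ?_
      · split_ifs with hm
        · rw [hm]
          exact hb m
        · exact one_mem _
      · refine mapClusterPt_iff_ultrafilter.2 ⟨U, hU, hba.congr' ?_⟩
        filter_upwards [hDev] with m hm
        rw [if_pos hm]
  subst hL
  refine ⟨F, ?_, rfl, ?_⟩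
  · induction z using Projectivization.ind with
    | h v hv =>
    refine F.eq_domain_of_isSubgeometry hZL hzZ ?_
    rw [F.domain_eq_negativeLines, mk_mem_negativeLines_iff]
    -- the rescaled forms are eventually negative on `z`, so that their limit is nonpositive
    refine lt_of_le_of_ne ?_ (F.headForm_ne_zero_of_isSubgeometry hZL hv hzZ)
    refine le_of_tendsto (hF.tendsto_headForm hs0 hlim hP v) ?_
    filter_upwards [hDev, hzY.filter_mono hU] with m hm hmz
    rw [mk_mem_negativeLines_iff, hm] at hmz
    exact (div_neg_of_neg_of_pos hmz (hs m 0)).le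
  -- the signature can be read off any one of the diagonal forms
  · obtain ⟨m, hm⟩ := hDev.exists
    have e := transportForm_equivalent β (g m)
    rw [hm] at e
    obtain ⟨h1, h2⟩ := sig_of_diagonal (hD m)
    rw [hF.sum_sig_eq.1, hF.sum_sig_eq.2, ← e.sigNeg_eq, ← e.sigPos_eq, h1, h2]
    have hsm := hs m
    simp only [mul_neg_iff, mul_pos_iff, hsm, (hsm _).not_gt, and_true, and_false, or_false,
      false_or]

end ConjugacyLimits

/-! ### The signature condition -/

section SignatureCondition

open Matrix QuadraticMap

variable {n : ℕ}

/-- **Sylvester's law of inertia**: nondegenerate forms with the same signature are equivalent. -/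
theorem exists_transportForm_eq {β β' : QuadraticForm ℝ (Fin n → ℝ)} (hβ : β.Nondegenerate)
    (hβ' : β'.Nondegenerate) (h : sigNeg β = sigNeg β') : ∃ g, transportForm β g = β' := by
  obtain ⟨P, ε, hε, hP⟩ := exists_diagonal_sign hβ
  obtain ⟨P', ε', hε', hP'⟩ := exists_diagonal_sign hβ'
  have hcard : Fintype.card {j // ε' j < 0} = Fintype.card {j // ε j < 0} := by
    rw [(sig_of_diagonal hP).1, (sig_of_diagonal hP').1, ← Finset.card_filter,
      ← Finset.card_filter] at h
    rw [Fintype.card_subtype, Fintype.card_subtype, h]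
  -- a permutation of the coordinates that matches the signs
  let σ : Equiv.Perm (Fin n) := (Fintype.equivOfCardEq hcard).extendSubtype
  have hσ : ∀ j, ε (σ j) = ε' j := by
    intro j
    by_cases hj : ε' j < 0
    · have h1 : ε (σ j) < 0 := Equiv.extendSubtype_mem (Fintype.equivOfCardEq hcard) j hj
      rcases hε (σ j) with h2 | h2 <;> rcases hε' j with h3 | h3 <;> linarith
    · have h1 : ¬ ε (σ j) < 0 := Equiv.extendSubtype_not_mem (Fintype.equivOfCardEq hcard) j hj
      rcases hε (σ j) with h2 | h2 <;> rcases hε' j with h3 | h3 <;> linarith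
  let S : GL (Fin n) ℝ := matrixOfEquiv (LinearEquiv.funCongrLeft ℝ ℝ σ.symm)
  have hS : ∀ (x : Fin n → ℝ) (j : Fin n), (S • x) (σ j) = x j := by
    intro x j
    rw [matrixOfEquiv_smul]
    simp [LinearEquiv.funCongrLeft_apply, LinearMap.funLeft_apply]
  refine ⟨P' * S⁻¹ * P⁻¹, ?_⟩
  ext x
  obtain ⟨y, rfl⟩ : ∃ y, x = P' • y := ⟨P'⁻¹ • x, by rw [smul_inv_smul]⟩
  rw [transportForm_apply, hP', _root_.mul_inv_rev, _root_.mul_inv_rev, inv_inv, inv_inv,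
    mul_smul, mul_smul, inv_smul_smul, hP, ← Equiv.sum_comp σ]
  exact Finset.sum_congr rfl fun j _ => by rw [hS, hσ]

theorem diagonalForm_nondegenerate (P : GL (Fin n) ℝ) {w : Fin n → ℝ} (hw : ∀ j, w j ≠ 0) :
    (diagonalForm P w).Nondegenerate := by
  refine nondegenerate_of_polar fun x hx => ?_
  obtain ⟨x, rfl⟩ : ∃ y, x = P • y := ⟨P⁻¹ • x, by rw [smul_inv_smul]⟩
  have : x = 0 := by
    ext j
    have h1 := hx (P • Pi.single j 1)
    rw [polar_diagonalForm, Finset.sum_eq_single j] at h1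
    · simpa [hw j] using h1
    · intro a _ ha
      simp [ha]
    · simp
  rw [this, smul_zero]

/-- The geometry of a nondegenerate form is the geometry of a partial flag of length one. -/
theorem exists_flag_eq_form (hn : 0 < n) {β : QuadraticForm ℝ (Fin n → ℝ)}
    (hβ : β.Nondegenerate) : ∃ F : PartialFlagOfForms n,
      negativeLines β = F.domain ∧ formPIsom β = F.pIsom ∧ F.p 0 = sigNeg β := by
  obtain ⟨P, ε, hε, hP⟩ := exists_diagonal_sign hβ
  have hε0 : ∀ j, ε j ≠ 0 := fun j => by rcases hε j with h | h <;> rw [h] <;> norm_num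
  have hd : Function.Surjective (fun _ : Fin n => (0 : Fin 1)) := fun i =>
    ⟨⟨0, hn⟩, (Subsingleton.elim _ _)⟩
  let F := PartialFlagOfForms.ofCoordinates P hd hε0
  have hF : F.IsAdapted P (fun _ => 0) ε :=
    PartialFlagOfForms.ofCoordinates_isAdapted P hd hε hε0
  have hhead : F.headForm = β := by
    ext x
    obtain ⟨y, rfl⟩ : ∃ y, x = P • y := ⟨P⁻¹ • x, by rw [smul_inv_smul]⟩
    rw [hF.headForm_smul_eq, hP]
    simp
  refine ⟨F, ?_, ?_, ?_⟩
  · rw [F.domain_eq_negativeLines, hhead]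
  · rw [formPIsom, PartialFlagOfForms.pIsom]
    congr 1
    ext G
    obtain ⟨A, rfl⟩ := exists_conj_eq P G
    rw [hF.conj_mem_isom_iff, conj_mem_formIsom_iff hP, IsBlockIsometry]
    have hblk : blockPart (fun _ : Fin n => (0 : Fin (F.k + 1))) A.1 = A.1 := by
      ext l j
      simp [blockPart_apply]
    rw [hblk]
    simp
  · rw [hF.p_eq, (sig_of_diagonal hP).1]
    simp

theorem isSubgeometry_form (hn : 0 < n) {β : QuadraticForm ℝ (Fin n → ℝ)}
    (hβ : β.Nondegenerate) (h : sigNeg β ≠ 0) :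
    IsSubgeometry (negativeLines β) (formPIsom β) := by
  obtain ⟨F, h1, h2, h3⟩ := exists_flag_eq_form hn hβ
  rw [h1, h2]
  exact F.isSubgeometry hn (h3 ▸ h)

namespace PartialFlagOfForms

theorem p_zero_ne_zero (F : PartialFlagOfForms n) {x : Fin n → ℝ} (hx : F.headForm x < 0) :
    F.p 0 ≠ 0 := by
  obtain ⟨P, d, ε, hF⟩ := F.exists_isAdapted
  obtain ⟨y, rfl⟩ : ∃ y, x = P • y := ⟨P⁻¹ • x, by rw [smul_inv_smul]⟩
  rw [hF.headForm_smul_eq] at hx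
  intro h0
  rw [hF.p_eq, Finset.sum_eq_zero_iff] at h0
  refine hx.not_ge (Finset.sum_nonneg fun j _ => ?_)
  have h1 := h0 j (Finset.mem_univ j)
  split_ifs at h1 ⊢ with h2 h3
  · exact mul_nonneg (not_lt.1 h3) (sq_nonneg _)
  · exact le_rfl

/-- The signature condition is necessary: the partial flag found by the compactness argument
satisfies it, and the forms of a partial flag are determined by its geometry up to scale, the
first one even up to a positive scale. -/
theorem signature_of_isConjugacyLimit (hn : 0 < n) {β : QuadraticForm ℝ (Fin n → ℝ)}
    (hβ : β.Nondegenerate) {F : PartialFlagOfForms n}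
    (h : IsConjugacyLimit (negativeLines β) (formPIsom β) F.domain F.pIsom) :
    F.p 0 ≠ 0 ∧ ∃ S : Finset (Fin (F.k + 1)), 0 ∉ S ∧
      ∑ i, (if i ∈ S then F.q i else F.p i) = sigNeg β ∧
      ∑ i, (if i ∈ S then F.p i else F.q i) = sigPos β := by
  classical
  obtain ⟨F', hdom, hiso, hp, hq⟩ := exists_flag_of_isConjugacyLimit hn hβ h
  obtain ⟨x, hx⟩ := h.2.1.isConnected.nonempty
  refine ⟨F.p_zero_ne_zero (x := x.rep) hx, ?_⟩
  obtain ⟨hk, hc⟩ := exists_mul_of_pIsom_eq hiso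
  choose c hc0 hval hcpos hcneg using hc
  -- both first forms are negative on a line of the common domain
  have h0 : 0 < c 0 := by
    have hx' : x ∈ F'.domain := hdom ▸ hx
    have h1 : F'.value 0 x.rep (F'.mem_V_zero _) = c 0 * F.value 0 x.rep (F.mem_V_zero _) :=
      hval 0 x.rep (F.mem_V_zero _) (F'.mem_V_zero _)
    have h2 : F.value 0 x.rep (F.mem_V_zero _) < 0 := hx
    have h3 : F'.value 0 x.rep (F'.mem_V_zero _) < 0 := hx'
    rw [h1] at h3
    exact (pos_iff_neg_of_mul_neg h3).2 h2
  refine ⟨Finset.univ.filter fun i => c i < 0, ?_, ?_, ?_⟩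
  · simpa using h0.le
  · rw [← hp, ← (finCongr hk).sum_comp]
    refine Finset.sum_congr rfl fun i _ => ?_
    rw [finCongr_apply]
    rcases lt_or_gt_of_ne (hc0 i) with h | h
    · simp [h, (hcneg i h).1]
    · simp [h.not_gt, (hcpos i h).1]
  · rw [← hq, ← (finCongr hk).sum_comp]
    refine Finset.sum_congr rfl fun i _ => ?_
    rw [finCongr_apply]
    rcases lt_or_gt_of_ne (hc0 i) with h | h
    · simp [h, (hcneg i h).2]
    · simp [h.not_gt, (hcpos i h).2]

/-- The signature condition is sufficient: in adapted coordinates, the forms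
`∑ ± ε j * (m + 1) ^ (- d j) * x j ^ 2` are equivalent to the given form, and degenerate to the
partial flag. -/
theorem isConjugacyLimit_of_signature (hn : 0 < n) {β : QuadraticForm ℝ (Fin n → ℝ)}
    (hβ : β.Nondegenerate) (hneg : sigNeg β ≠ 0) (F : PartialFlagOfForms n) (h0 : F.p 0 ≠ 0)
    {S : Finset (Fin (F.k + 1))} (hS0 : 0 ∉ S)
    (hS : ∑ i, (if i ∈ S then F.q i else F.p i) = sigNeg β) :
    IsConjugacyLimit (negativeLines β) (formPIsom β) F.domain F.pIsom := by
  obtain ⟨P, d, ε, hF⟩ := F.exists_isAdapted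
  -- the sign of a level records whether its signature is exchanged
  let τ : Fin (F.k + 1) → ℝ := fun i => if i ∈ S then -1 else 1
  have hτ : ∀ i, τ i ≠ 0 := fun i => by
    simp only [τ]
    split_ifs <;> norm_num
  let s : ℕ → Fin (F.k + 1) → ℝ := fun m i => τ i * (((m : ℝ) + 1)⁻¹) ^ (i : ℕ)
  have hm : ∀ m : ℕ, 0 < ((m : ℝ) + 1)⁻¹ := fun m => by positivity
  have hs : ∀ m i, s m i ≠ 0 := fun m i => mul_ne_zero (hτ i) (pow_pos (hm m) _).ne'
  have hlim : ∀ i i', i < i' → Tendsto (fun m => s m i' / s m i) atTop (𝓝 0) := by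
    intro i i' hii'
    have h1 : Tendsto (fun m : ℕ => ((m : ℝ) + 1)⁻¹) atTop (𝓝 0) := by
      simpa using tendsto_one_div_add_atTop_nhds_zero_nat (𝕜 := ℝ)
    have h2 := (h1.pow ((i' : ℕ) - i)).const_mul (τ i' / τ i)
    rw [zero_pow (Nat.sub_pos_of_lt hii').ne', mul_zero] at h2
    refine h2.congr fun m => ?_
    have h3 := (pow_pos (hm m) (i : ℕ)).ne'
    have h4 : (((m : ℝ) + 1)⁻¹) ^ (i' : ℕ) =
        (((m : ℝ) + 1)⁻¹) ^ ((i' : ℕ) - i) * (((m : ℝ) + 1)⁻¹) ^ (i : ℕ) := by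
      rw [← pow_add, Nat.sub_add_cancel (Nat.le_of_lt hii')]
    simp only [s]
    rw [h4, ← mul_assoc, mul_div_mul_right _ _ h3]
    ring
  let D : ℕ → QuadraticForm ℝ (Fin n → ℝ) := fun m => diagonalForm P fun j => ε j * s m (d j)
  have hD : ∀ m x, D m (P • x) = ∑ j, ε j * s m (d j) * x j ^ 2 := fun m x =>
    diagonalForm_apply_smul _ _ _
  have hDsig : ∀ m, sigNeg β = sigNeg (D m) := by
    intro m
    rw [(sig_of_diagonal (hD m)).1, ← hS, hF.sum_p_eq S]
    refine Finset.sum_congr rfl fun j _ => ?_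
    have h1 : ε j * s m (d j) =
        (if d j ∈ S then -ε j else ε j) * (((m : ℝ) + 1)⁻¹) ^ (d j : ℕ) := by
      simp only [s, τ]
      split_ifs <;> ring
    have h2 := pow_pos (hm m) (d j : ℕ)
    simp only [h1, mul_neg_iff, h2, h2.not_gt, and_false, false_or, and_true]
  choose g hg using fun m => exists_transportForm_eq hβ
    (diagonalForm_nondegenerate P fun j => mul_ne_zero (hF.ne_zero j) (hs m (d j))) (hDsig m)
  obtain ⟨e, he⟩ := F.exists_headForm_neg h0
  have he0 : e ≠ 0 := by
    rintro rfl
    rw [QuadraticMap.map_zero] at he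
    exact lt_irrefl _ he
  have hgD : ∀ m, transportForm β (g m) = D m := hg
  refine ⟨isSubgeometry_form hn hβ hneg, F.isSubgeometry hn h0,
    fun m => Matrix.ProjGenLinGroup.mk (g m), ⟨?_, ?_⟩, Projectivization.mk ℝ e he0, ?_, ?_⟩
  · intro a ha
    simp_rw [map_conj_formPIsom, hgD]
    exact hF.exists_tendsto_of_mem_pIsom hs hlim tendsto_const_nhds hD ha
  · simp_rw [map_conj_formPIsom, hgD]
    intro b hb a ha
    obtain ⟨U, hU, hUa⟩ := mapClusterPt_iff_ultrafilter.1 ha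
    exact hF.mem_pIsom_of_tendsto hn hs (fun i i' hii' => (hlim i i' hii').mono_left hU)
      tendsto_const_nhds hD hb hUa
  · rw [domain_eq_negativeLines, mk_mem_negativeLines_iff]
    exact he
  · simp_rw [image_smul_negativeLines, hgD, mk_mem_negativeLines_iff]
    have h1 := hF.tendsto_headForm hs hlim (tendsto_const_nhds (x := P)) e
    have h2 : ∀ m, s m 0 = 1 := fun m => by simp [s, τ, hS0]
    simp only [h2, div_one] at h1
    exact h1.eventually_lt_const he

end PartialFlagOfForms

end SignatureCondition

theorem mainTheorem4 (n p q : ℕ) (hp : 0 < p)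
    (β : QuadraticForm ℝ (Fin n → ℝ)) (hβ : β.Nondegenerate)
    (hneg : sigNeg β = p) (hpos : sigPos β = q) :
    (∀ (Z : Set (ℙ ℝ (Fin n → ℝ))) (L : Subgroup PGL(Fin n, ℝ)),
      IsConjugacyLimit (negativeLines β) (formPIsom β) Z L →
        ∃ F : PartialFlagOfForms n, Z = F.domain ∧ L = F.pIsom) ∧
    (∀ F : PartialFlagOfForms n,
      IsConjugacyLimit (negativeLines β) (formPIsom β) F.domain F.pIsom ↔
        F.p 0 ≠ 0 ∧
        ∃ S : Finset (Fin (F.k + 1)), 0 ∉ S ∧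
          ∑ i, (if i ∈ S then F.q i else F.p i) = p ∧
          ∑ i, (if i ∈ S then F.p i else F.q i) = q) := by
  subst hneg hpos
  have hn : 0 < n := by
    refine Nat.pos_of_ne_zero ?_
    rintro rfl
    have h1 := sigPos_le_finrank (-β)
    rw [sigPos_neg, Module.finrank_fin_fun] at h1
    exact hp.not_ge h1
  refine ⟨fun Z L h => ?_, fun F => ⟨F.signature_of_isConjugacyLimit hn hβ, ?_⟩⟩
  · obtain ⟨F, hZ, hL, -⟩ := exists_flag_of_isConjugacyLimit hn hβ h
    exact ⟨F, hZ, hL⟩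
  · rintro ⟨h0, S, hS0, hS, -⟩
    exact F.isConjugacyLimit_of_signature hn hβ hp.ne' h0 hS0 hS
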